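/- Let $u>0$ and let $p(z)=\sum_{r=0}^{R}p_r z^r$ be a polynomial of degree $R$ with complex coefficients (for $p=0$ put $R=0$). Let $\mathrm{Ai}$ be the Airy function, $\mathrm{Ai}_j(z)=\mathrm{Ai}(ze^{-2\pi ij/3})$, and let $\mathrm{Hi}(z)=\frac1\pi\int_0^\infty \exp(-\tfrac13t^3+zt)\,dt$ be the Scorer function. For $(j,k)\in\{(-1,1),(-1,0),(0,1)\}$ put $$\mathrm{Wi}^{(j,k)}(z)=\pi e^{2\pi i(j+k)/3}\,\mathrm{Hi}\bigl(ze^{2\pi i(j+k)/3}\bigr),$$ and let $w^{(j,k)}(u,z)$ be the fundamental solution of the inhomogeneous Airy equation $$\frac{d^2w}{dz^2}-u^2zw=p(z),$$ $$w^{(j,k)}(u,z)=\kappa_{j,k}\,u^{-2/3}\Bigl\{\mathrm{Ai}_j(u^{2/3}z)\int_{\infty e^{2\pi ik/3}}^{z}p(t)\,\mathrm{Ai}_k(u^{2/3}t)\,dt-\mathrm{Ai}_k(u^{2/3}z)\int_{\infty e^{2\pi ij/3}}^{z}p(t)\,\mathrm{Ai}_j(u^{2/3}t)\,dt\Bigr\},$$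 where $\kappa_{-1,1}=2\pi i$, $\kappa_{-1,0}=2\pi e^{\pi i/6}$, $\kappa_{0,1}=-2\pi e^{-\pi i/6}$. For $l\in\{-1,0,1\}$ let $S_l=\{z:|\arg(ze^{-2\pi il/3})|\le\pi/3\}$. Then the improper integrals converge, and $w^{(j,k)}(u,\cdot)$ is the unique entire solution of the equation that is slowly varying in $S_j\cup S_k$, in the following sense: with $\hat G_0(z)=-p(z)/z$ and $\hat G_{s+1}(z)=\hat G_s''(z)/z$, for every $n\ge R/3$ and every $\delta>0$, $$w(z)=\frac1{u^2}\sum_{s=0}^{n-1}\frac{\hat G_s(z)}{u^{2s}}+\mathcal O\bigl(z^{-1}\bigr)$$ as $z\to\infty$ in $S_j\cup S_k$ with an angle $\delta$ removed at both outer edges. Moreover, for all $z\in\mathbb C$, $$w^{(j,k)}(u,z)=\gamma(u)\,\mathrm{Wi}^{(j,k)}(u^{2/3}z)+\mathcal G(u,z),$$ where $$\gamma(u)=\frac1{u^{4/3}}\sum_{s=0}^{\lfloor R/3\rfloor}\frac{(3s)!\,p_{3s}}{3^s\,s!\,u^{2s}},\qquad \mathcal G(u,z)=-\sum_{r=0}^{R}u^{-2(r+2)/3}\,p_r\,Q_{r-1}(u^{2/3}z).$$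 Here $Q_{-1}=0$ and, for $r\ge0$, $Q_r(z)=\sum_{m=0}^{\lfloor r/3\rfloor}q_{r-3m}(r)\,z^{r-3m}$ with $q_r(r)=1$ and $q_l(r)=(l+2)(l+3)\,q_{l+3}(r)$ for $l=r-3,r-6,\dots,\,r\bmod 3$. -/

import Mathlib

open Complex MeasureTheory Set Filter Asymptotics Polynomial

noncomputable section

/-- The Airy function, by its contour integral
`Ai(z) = (1 / 2πi) ∫ exp (t³ / 3 - z t) dt` from `∞ e^{-πi/3}` to `∞ e^{πi/3}`,
the contour being the two rays `t = s e^{∓πi/3}`, on which `t³ = -s³`. -/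
def airyAi (z : ℂ) : ℂ :=
  (2 * Real.pi * I)⁻¹ *
    ((∫ s in Ioi (0 : ℝ), exp (-(s : ℂ) ^ 3 / 3 - z * (s * exp (Real.pi * I / 3))) *
        exp (Real.pi * I / 3)) -
      ∫ s in Ioi (0 : ℝ), exp (-(s : ℂ) ^ 3 / 3 - z * (s * exp (-(Real.pi * I / 3)))) *
        exp (-(Real.pi * I / 3)))

/-- The rotated Airy function `Ai_j(z) = Ai(z e^{-2πij/3})`. -/
def airyAiRot (j : ℤ) (z : ℂ) : ℂ :=
  airyAi (z * exp (-(2 * Real.pi * I * j / 3)))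

/-- The Scorer function `Hi(z) = (1 / π) ∫₀^∞ exp (-t³ / 3 + z t) dt`. -/
def scorerHi (z : ℂ) : ℂ :=
  (Real.pi : ℂ)⁻¹ * ∫ t in Ioi (0 : ℝ), exp (-(t : ℂ) ^ 3 / 3 + z * t)

/-- The scaled Scorer functions `Wi^{(j,k)}`: with `(j,k) = (-1,1), (0,1), (-1,0)` these are
`π Hi(z)`, `π e^{2πi/3} Hi(z e^{2πi/3})` and `π e^{-2πi/3} Hi(z e^{-2πi/3})`. -/
def scorerWi (j k : ℤ) (z : ℂ) : ℂ :=
  Real.pi * exp (2 * Real.pi * I * (j + k) / 3) *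
    scorerHi (z * exp (2 * Real.pi * I * (j + k) / 3))

/-- The contour integral `∫ g(t) dt` from `∞ e^{2πij/3}` to `z`, taken along the ray from
`∞ e^{2πij/3}` to `0` and then along the segment from `0` to `z`. -/
def integralFromInfinity (j : ℤ) (g : ℂ → ℂ) (z : ℂ) : ℂ :=
  (∫ s in (0 : ℝ)..1, g (s * z) * z) -
    ∫ s in Ioi (0 : ℝ), g (s * exp (2 * Real.pi * I * j / 3)) * exp (2 * Real.pi * I * j / 3)

/-- Convergence of the improper integrals from `∞ e^{2πij/3}`. -/
def ConvergesAtInfinity (j : ℤ) (g : ℂ → ℂ) : Prop :=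
  IntegrableOn
    (fun s : ℝ => g (s * exp (2 * Real.pi * I * j / 3)) * exp (2 * Real.pi * I * j / 3)) (Ioi 0)

/-- The integrand `p(t) Ai_j(u^{2/3} t)`. -/
def airyIntegrand (u : ℝ) (p : ℂ[X]) (j : ℤ) (t : ℂ) : ℂ :=
  p.eval t * airyAiRot j ((u ^ (2 / 3 : ℝ) : ℝ) * t)

/-- The three fundamental solutions `w^{(j,k)}(u,z)` of `w'' - u² z w = p`, from variation of
parameters. The constant `exp (πi/2 + πi(j+k)/3)` is the reciprocal of `2π` times the Wronskian of
`Ai_k` and `Ai_j`: it equals `i` for `(-1,1)`, `e^{πi/6}` for `(-1,0)` and `-e^{-πi/6}` for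
`(0,1)`. -/
def airyFundamental (u : ℝ) (p : ℂ[X]) (j k : ℤ) (z : ℂ) : ℂ :=
  2 * Real.pi * exp (Real.pi * I / 2 + Real.pi * I * (j + k) / 3) * (u ^ (-(2 / 3) : ℝ) : ℝ) *
    (airyAiRot j ((u ^ (2 / 3 : ℝ) : ℝ) * z) * integralFromInfinity k (airyIntegrand u p k) z -
      airyAiRot k ((u ^ (2 / 3 : ℝ) : ℝ) * z) * integralFromInfinity j (airyIntegrand u p j) z)

/-- The coefficients of the slowly varying expansion:
`Ĝ₀(z) = -p(z) / z` and `Ĝ_{s+1}(z) = Ĝ_s''(z) / z`. -/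
def slowCoeff (p : ℂ[X]) : ℕ → ℂ → ℂ
  | 0 => fun z => -p.eval z / z
  | s + 1 => fun z => deriv (deriv (slowCoeff p s)) z / z

/-- The union `S_j ∪ S_k` of the sectors `S_i = {|arg (z e^{-2πii/3})| ≤ π/3}`, with an angle `δ`
removed at both of its outer edges. For indices `-1 ≤ j < k ≤ 1` this union is the sector of
half-angle `2π/3` about the direction `-e^{-2πi(j+k)/3}`. -/
def trimmedSector (j k : ℤ) (δ : ℝ) : Set ℂ :=
  {z : ℂ | |arg (-(z * exp (2 * Real.pi * I * (j + k) / 3)))| ≤ 2 * Real.pi / 3 - δ}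

/-- `w` is an entire solution of `w'' - u² z w = p` that is slowly varying in `S_j ∪ S_k`: there
it is `u⁻² ∑_{s<n} Ĝ_s(z) / u^{2s}` up to `O(1/z)` as `z → ∞`, uniformly away from
the edges, whenever enough terms are taken for `Ĝ_n(z)` to be `O(1/z)`. -/
structure IsSlowlyVaryingSolution (u : ℝ) (p : ℂ[X]) (j k : ℤ) (w : ℂ → ℂ) : Prop where
  differentiable : Differentiable ℂ w
  ode : ∀ z : ℂ, deriv (deriv w) z - (u : ℂ) ^ 2 * z * w z = p.eval z
  slowly_varying : ∀ δ : ℝ, 0 < δ → ∀ n : ℕ, p.natDegree ≤ 3 * n →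
    (fun z : ℂ => w z -
        1 / (u : ℂ) ^ 2 * ∑ s ∈ Finset.range n, slowCoeff p s z / (u : ℂ) ^ (2 * s))
      =O[Bornology.cobounded ℂ ⊓ 𝓟 (trimmedSector j k δ)] fun z : ℂ => z⁻¹

/-- `airyQCoeff r m` is the coefficient `q_{r-3m}(r)` of `z^{r-3m}` in `Q_r` (for `3 m ≤ r`),
given by `q_r(r) = 1` and `q_i(r) = (i+2)(i+3) q_{i+3}(r)`. -/
def airyQCoeff (r : ℕ) : ℕ → ℕ
  | 0 => 1
  | m + 1 => (r - 3 * (m + 1) + 2) * (r - 3 * (m + 1) + 3) * airyQCoeff r m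

/-- The polynomial `Q_r(z) = ∑_{m ≤ ⌊r/3⌋} q_{r-3m}(r) z^{r-3m}`. -/
def airyQ (r : ℕ) (z : ℂ) : ℂ :=
  ∑ m ∈ Finset.range (r / 3 + 1), (airyQCoeff r m : ℂ) * z ^ (r - 3 * m)

/-- The connection coefficient
`γ(u) = u^{-4/3} ∑_{s ≤ ⌊R/3⌋} (3s)! p_{3s} / (3^s s! u^{2s})`, with `R` the degree of `p`. -/
def connectionGamma (u : ℝ) (p : ℂ[X]) : ℂ :=
  1 / ((u ^ (4 / 3 : ℝ) : ℝ) : ℂ) * ∑ s ∈ Finset.range (p.natDegree / 3 + 1),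
    ((3 * s).factorial : ℂ) * p.coeff (3 * s) /
      (3 ^ s * (s.factorial : ℂ) * (u : ℂ) ^ (2 * s))

/-- The polynomial part
`𝒢(u,z) = -∑_{r=1}^{R} u^{-2(r+2)/3} p_r Q_{r-1}(u^{2/3} z)`
(the term `r = 0` is absent, `Q_{-1}` being `0`). -/
def polynomialPart (u : ℝ) (p : ℂ[X]) (z : ℂ) : ℂ :=
  -∑ r ∈ Finset.Icc 1 p.natDegree, ((u ^ (-(2 * ((r : ℝ) + 2) / 3)) : ℝ) : ℂ) * p.coeff r *
    airyQ (r - 1) ((u ^ (2 / 3 : ℝ) : ℝ) * z)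

end

/-! ### Scorer moments and rotation of the contour. -/

section ScorerMoments

open Topology

/-! The combination `γ Wi + 𝒢` (`scorerSolution`) is studied first; the integral formula is
identified with it at the end.

It solves the equation by algebra. Each `Wi` satisfies `W'' = zW + 1`, and `Q_{r-1}'' = z Q_{r-1} -
z^r + const`, with a nonzero constant only for `3 ∣ r` (`deriv_deriv_airyQ`); `γ` collects these
constants. It is slowly varying because rotating the Scorer contour by less than `π/6` makes `Wi =
O(1/z)` in the trimmed sector (`norm_scorerMoment_zero_le`), while `𝒢` consists of the monomials of
nonnegative degree in the sum of the `Ĝ_s` (`polynomialPart_sub_slow_sum`).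

To identify the integrals, let `w` be this solution and `a` the scaled `Ai_l`. Then `w'a - wa'` is a
primitive of `p a` that vanishes at infinity along ray `l`, so it equals the integral
(`integralFromInfinity_airyIntegrand`). In the fundamental solution the terms in `w'` cancel, and
what remains is `w` times a constant Wronskian. No Airy asymptotics are needed: `Ai` is bounded on
the positive axis as a combination of two Scorer moments, and convexity turns boundedness into decay
beyond every exponential.

For uniqueness, the difference `g` of two solutions satisfies `g'' = u² z g` and is bounded on the
rays `j` and `k`. An energy identity makes `v * conj (g 0) * g' 0` real and nonpositive for two
distinct cube roots of unity `v`, so the product vanishes and `g = 0`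
(`eq_zero_of_bounded_on_rays`). -/

lemma pow_mul_exp_cubic_isBigO (n : ℕ) {c : ℝ} (hc : 0 < c) (d : ℝ) :
    (fun s : ℝ => s ^ n * Real.exp (-c * s ^ 3 + d * s)) =O[atTop]
      fun s => Real.exp (-1 * s) := by
  have h1 := (isLittleO_pow_exp_pos_mul_atTop n (b := 1) one_pos).isBigO
  -- Rate 2 instead of 1 leaves a factor `exp (-s)` to absorb `s ^ n`.
  have h2 : (fun s : ℝ => Real.exp (-c * s ^ 3 + d * s)) =O[atTop]
      fun s => Real.exp (-2 * s) := by
    refine IsBigO.of_bound 1 ?_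
    filter_upwards [eventually_ge_atTop (max 1 ((|d| + 2) / c))] with s hs
    have hs1 : 1 ≤ s := (le_max_left _ _).trans hs
    have hs2 : |d| + 2 ≤ s * c := (div_le_iff₀ hc).1 ((le_max_right _ _).trans hs)
    rw [Real.norm_eq_abs, Real.norm_eq_abs, Real.abs_exp, Real.abs_exp, one_mul]
    apply Real.exp_le_exp.2
    have hd := le_abs_self d
    have h3 : (|d| + 2) * s ≤ c * s ^ 3 := by
      have h4 : s * c * s ≤ c * s ^ 3 := by
        have : 0 ≤ c * s ^ 2 * (s - 1) := by have := sub_nonneg.2 hs1; positivity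
        nlinarith
      nlinarith
    nlinarith
  refine (h1.mul h2).congr_right fun s => ?_
  rw [← Real.exp_add]; ring_nf

lemma integrableOn_pow_mul_exp_cubic (n : ℕ) {c : ℝ} (hc : 0 < c) (d : ℝ) :
    IntegrableOn (fun s : ℝ => s ^ n * Real.exp (-c * s ^ 3 + d * s)) (Ioi 0) :=
  integrable_of_isBigO_exp_neg one_pos (by fun_prop) (pow_mul_exp_cubic_isBigO n hc d)

/-- A direction `b` enters the modulus only through `Re b³` and `Re (z b)`, so `Re b³ > 0` is the
condition for cubic decay. -/
lemma norm_pow_mul_exp_cubic (n : ℕ) (b z : ℂ) {s : ℝ} (hs : 0 ≤ s) :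
    ‖(s : ℂ) ^ n * exp (-(b * s) ^ 3 / 3 + z * (b * s))‖ =
      s ^ n * Real.exp (-((b ^ 3).re / 3) * s ^ 3 + (z * b).re * s) := by
  rw [norm_mul, norm_pow, norm_real, Real.norm_of_nonneg hs, norm_exp]
  congr 2
  have : -(b * s) ^ 3 / 3 + z * (b * s) =
      ((-(s ^ 3 / 3) : ℝ) : ℂ) * b ^ 3 + (s : ℂ) * (z * b) := by push_cast; ring
  rw [this, add_re, re_ofReal_mul, re_ofReal_mul]
  ring

lemma integrableOn_pow_mul_cexp_cubic (n : ℕ) {b : ℂ} (hb : 0 < (b ^ 3).re) (z : ℂ) :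
    IntegrableOn (fun s : ℝ => (s : ℂ) ^ n * exp (-(b * s) ^ 3 / 3 + z * (b * s))) (Ioi 0) := by
  refine (integrableOn_pow_mul_exp_cubic n (div_pos hb three_pos) (z * b).re).mono'
    (by fun_prop) ?_
  filter_upwards [ae_restrict_mem measurableSet_Ioi] with s hs
  exact (norm_pow_mul_exp_cubic n b z (le_of_lt hs)).le

lemma tendsto_pow_mul_cexp_cubic (n : ℕ) {b : ℂ} (hb : 0 < (b ^ 3).re) (z : ℂ) :
    Tendsto (fun s : ℝ => (s : ℂ) ^ n * exp (-(b * s) ^ 3 / 3 + z * (b * s))) atTop (𝓝 0) := by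
  rw [tendsto_zero_iff_norm_tendsto_zero]
  have h := (pow_mul_exp_cubic_isBigO n (div_pos hb three_pos) (z * b).re).trans_tendsto
    (Real.tendsto_exp_atBot.comp (tendsto_id.const_mul_atTop_of_neg (by norm_num : (-1 : ℝ) < 0)))
  refine h.congr' ?_
  filter_upwards [eventually_ge_atTop 0] with s hs
  exact (norm_pow_mul_exp_cubic n b z hs).symm

/-- The moments `∫₀^∞ tⁿ exp (-t³ / 3 + z t) dt`. -/
noncomputable def scorerMoment (n : ℕ) (z : ℂ) : ℂ :=
  ∫ s in Ioi (0 : ℝ), (s : ℂ) ^ n * exp (-(s : ℂ) ^ 3 / 3 + z * s)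

lemma hasDerivAt_scorerMoment (n : ℕ) (z : ℂ) :
    HasDerivAt (scorerMoment n) (scorerMoment (n + 1) z) z := by
  have hint : ∀ m : ℕ, ∀ z : ℂ, IntegrableOn
      (fun s : ℝ => (s : ℂ) ^ m * exp (-(s : ℂ) ^ 3 / 3 + z * s)) (Ioi 0) := fun m z => by
    simpa using integrableOn_pow_mul_cexp_cubic m (b := 1) (by simp) z
  refine (hasDerivAt_integral_of_dominated_loc_of_deriv_le
    (F := fun z (s : ℝ) => (s : ℂ) ^ n * exp (-(s : ℂ) ^ 3 / 3 + z * s))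
    (F' := fun z (s : ℝ) => (s : ℂ) ^ (n + 1) * exp (-(s : ℂ) ^ 3 / 3 + z * s))
    (bound := fun s : ℝ => s ^ (n + 1) * Real.exp (-(1 / 3) * s ^ 3 + (‖z‖ + 1) * s))
    (Metric.ball_mem_nhds z one_pos) (Eventually.of_forall fun w => (hint n w).aestronglyMeasurable)
    (hint n z) (hint (n + 1) z).aestronglyMeasurable ?_
    (integrableOn_pow_mul_exp_cubic _ (by norm_num) _) ?_).2
  · filter_upwards [ae_restrict_mem measurableSet_Ioi] with s hs w hw
    have h := norm_pow_mul_exp_cubic (n + 1) 1 w (le_of_lt hs)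
    simp only [one_mul, mul_one, one_pow, one_re] at h
    rw [h]
    have hw' : w.re ≤ ‖z‖ + 1 := by
      have h1 := norm_le_norm_add_norm_sub' w z
      have h2 := mem_ball_iff_norm.1 hw
      linarith [re_le_norm w]
    have hs' : 0 < s := hs
    gcongr
  · refine Eventually.of_forall fun s w _ => ?_
    have h : HasDerivAt (fun w : ℂ => -(s : ℂ) ^ 3 / 3 + w * s) (s : ℂ) w := by
      simpa using ((hasDerivAt_id w).mul_const (s : ℂ)).const_add (-(s : ℂ) ^ 3 / 3)
    refine (h.cexp.const_mul ((s : ℂ) ^ n)).congr_deriv ?_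
    ring

lemma hasDerivAt_cubic_exponent (b z : ℂ) (s : ℝ) :
    HasDerivAt (fun s : ℝ => exp (-(b * s) ^ 3 / 3 + z * (b * s)))
      (exp (-(b * s) ^ 3 / 3 + z * (b * s)) * (-(b ^ 3 * s ^ 2) + z * b)) s := by
  have h0 : HasDerivAt (fun s : ℝ => b * (s : ℂ)) b s := by
    simpa using (hasDerivAt_id (s : ℂ)).comp_ofReal.const_mul b
  have h := (((h0.pow 3).neg.div_const 3).add (h0.const_mul z)).cexp
  refine h.congr_deriv ?_
  simp only [Pi.add_apply, Pi.neg_apply, Pi.pow_apply]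
  push_cast
  ring

/-- Integration of the total derivative `(z - t²) exp (-t³/3 + zt)`; the boundary value at `0` gives
the inhomogeneity of the Scorer equation. -/
lemma scorerMoment_two (z : ℂ) : scorerMoment 2 z = z * scorerMoment 0 z + 1 := by
  have hb : 0 < ((1 : ℂ) ^ 3).re := by simp
  have hi := fun n => integrableOn_pow_mul_cexp_cubic n hb z
  have h := integral_Ioi_of_hasDerivAt_of_tendsto' (a := 0)
    (f := fun s : ℝ => exp (-(1 * (s : ℂ)) ^ 3 / 3 + z * (1 * s)))
    (fun s _ => hasDerivAt_cubic_exponent 1 z s) ?_ (m := 0)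
    (by simpa using tendsto_pow_mul_cexp_cubic 0 hb z)
  · have e : (fun s : ℝ => exp (-(1 * (s : ℂ)) ^ 3 / 3 + z * (1 * s)) *
        (-(1 ^ 3 * (s : ℂ) ^ 2) + z * 1)) = fun s : ℝ =>
        z * ((s : ℂ) ^ 0 * exp (-(1 * (s : ℂ)) ^ 3 / 3 + z * (1 * s))) -
          (s : ℂ) ^ 2 * exp (-(1 * (s : ℂ)) ^ 3 / 3 + z * (1 * s)) := by
      ext s; ring
    rw [e, integral_sub ((hi 0).const_mul z) (hi 2), integral_const_mul] at h
    simp only [one_mul] at h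
    change z * scorerMoment 0 z - scorerMoment 2 z = _ at h
    simp at h
    linear_combination -h
  · refine (((hi 0).const_mul z).sub (hi 2)).congr (Eventually.of_forall fun s => ?_)
    simp only [Pi.sub_apply]
    ring

/-- The integral of `exp (-t³ / 3 + z t)` along the ray from `0` through `b`. -/
noncomputable def scorerRay (z b : ℂ) : ℂ :=
  ∫ s in Ioi (0 : ℝ), b * exp (-(b * s) ^ 3 / 3 + z * (b * s))

/-- The `b`-derivative of the integrand is the `s`-derivative of `s exp (-(bs)³/3 + zbs)`, which
vanishes at both ends. This stands in for Cauchy's theorem when the contour is rotated. -/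
lemma hasDerivAt_scorerRay (z : ℂ) {b : ℂ} (hb : 0 < (b ^ 3).re) :
    HasDerivAt (scorerRay z) 0 b := by
  set c : ℝ := (b ^ 3).re / 2
  have hc : 0 < c := half_pos hb
  -- On this neighbourhood `Re x³` is bounded below and `‖x‖` above, so one dominating function
  -- serves for all `x`.
  have hmem : {x : ℂ | c < (x ^ 3).re} ∩ Metric.ball b 1 ∈ 𝓝 b := by
    refine inter_mem (IsOpen.mem_nhds ?_ (half_lt_self hb)) (Metric.ball_mem_nhds b one_pos)
    exact isOpen_lt continuous_const (by fun_prop)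
  have hi := fun n => integrableOn_pow_mul_cexp_cubic n hb z
  set B := ‖z‖ * (‖b‖ + 1)
  have hB := fun n => integrableOn_pow_mul_exp_cubic n (div_pos hc three_pos) B
  have hint' : IntegrableOn (fun s : ℝ => exp (-(b * s) ^ 3 / 3 + z * (b * s)) *
      (1 - (b * s) ^ 3 + z * (b * s))) (Ioi 0) := by
    refine (((hi 0).add ((hi 1).const_mul (z * b))).sub ((hi 3).const_mul (b ^ 3))).congr
      (Eventually.of_forall fun s => ?_)
    simp only [Pi.sub_apply, Pi.add_apply]
    ring
  have key := hasDerivAt_integral_of_dominated_loc_of_deriv_le (μ := volume.restrict (Ioi 0))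
    (F := fun b (s : ℝ) => b * exp (-(b * s) ^ 3 / 3 + z * (b * s)))
    (F' := fun b (s : ℝ) => exp (-(b * s) ^ 3 / 3 + z * (b * s)) *
      (1 - (b * s) ^ 3 + z * (b * s)))
    (bound := fun s : ℝ => s ^ 0 * Real.exp (-(c / 3) * s ^ 3 + B * s) +
      (‖b‖ + 1) ^ 3 * (s ^ 3 * Real.exp (-(c / 3) * s ^ 3 + B * s)) +
      B * (s ^ 1 * Real.exp (-(c / 3) * s ^ 3 + B * s)))
    hmem (Eventually.of_forall fun w => by fun_prop)
    (by simpa using (hi 0).const_mul b) hint'.aestronglyMeasurable ?_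
    (Integrable.add (Integrable.add (hB 0) ((hB 3).const_mul ((‖b‖ + 1) ^ 3)))
      ((hB 1).const_mul B)) ?_
  · refine key.2.congr_deriv ?_
    have h := integral_Ioi_of_hasDerivAt_of_tendsto' (a := 0) (m := 0)
      (f := fun s : ℝ => (s : ℂ) * exp (-(b * (s : ℂ)) ^ 3 / 3 + z * (b * s)))
      (f' := fun s : ℝ => exp (-(b * s) ^ 3 / 3 + z * (b * s)) *
      (1 - (b * s) ^ 3 + z * (b * s))) (fun s _ => ?_) hint'
      (by simpa using tendsto_pow_mul_cexp_cubic 1 hb z)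
    · rw [h]; simp
    · refine ((hasDerivAt_id (s : ℂ)).comp_ofReal.mul
        (hasDerivAt_cubic_exponent b z s)).congr_deriv ?_
      simp only [id]
      ring
  · filter_upwards [ae_restrict_mem measurableSet_Ioi] with s hs x hx
    have hs' : 0 < s := hs
    have h := norm_pow_mul_exp_cubic 0 x z hs'.le
    simp only [pow_zero, one_mul] at h
    have hx' : ‖x‖ ≤ ‖b‖ + 1 := by
      have h1 := norm_le_norm_add_norm_sub' x b
      have h2 := mem_ball_iff_norm.1 hx.2
      linarith
    have hzx : ‖z‖ * ‖x‖ ≤ B := mul_le_mul_of_nonneg_left hx' (norm_nonneg z)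
    have h1 : Real.exp (-((x ^ 3).re / 3) * s ^ 3 + (z * x).re * s) ≤
        Real.exp (-(c / 3) * s ^ 3 + B * s) := by
      have h2 : (z * x).re ≤ B := (re_le_norm _).trans ((norm_mul z x).le.trans hzx)
      have h3 : c ≤ (x ^ 3).re := le_of_lt hx.1
      gcongr
    have h4 : ‖1 - (x * s) ^ 3 + z * (x * s)‖ ≤ 1 + (‖b‖ + 1) ^ 3 * s ^ 3 + B * s := by
      refine (norm_add_le _ _).trans (add_le_add ((norm_sub_le _ _).trans ?_) ?_)
      · simp only [norm_one, norm_pow, norm_mul, norm_real, Real.norm_of_nonneg hs'.le, mul_pow]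
        gcongr
      · simp only [norm_mul, norm_real, Real.norm_of_nonneg hs'.le, ← mul_assoc]
        exact mul_le_mul_of_nonneg_right hzx hs'.le
    rw [norm_mul, h]
    calc _ ≤ Real.exp (-(c / 3) * s ^ 3 + B * s) * (1 + (‖b‖ + 1) ^ 3 * s ^ 3 + B * s) := by
          gcongr
      _ = _ := by ring
  · refine Eventually.of_forall fun s x _ => ?_
    have h0 : HasDerivAt (fun x : ℂ => x * (s : ℂ)) s x := hasDerivAt_mul_const _
    have h := (hasDerivAt_id x).mul (((h0.pow 3).neg.div_const 3).add (h0.const_mul z)).cexp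
    refine h.congr_deriv ?_
    simp only [Pi.add_apply, Pi.neg_apply, Pi.pow_apply, id]
    push_cast
    ring

lemma re_exp_mul_I_pow_three_pos {t : ℝ} (ht : t ∈ Ioo (-(Real.pi / 6)) (Real.pi / 6)) :
    0 < ((exp (t * I)) ^ 3).re := by
  rw [← Complex.exp_nat_mul]
  have : ((3 : ℕ) : ℂ) * (t * I) = ((3 * t : ℝ) : ℂ) * I := by push_cast; ring
  rw [this, exp_ofReal_mul_I_re]
  exact Real.cos_pos_of_mem_Ioo ⟨by linarith [ht.1], by linarith [ht.2]⟩

lemma scorerMoment_zero_eq_scorerRay (z : ℂ) {t : ℝ}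
    (ht : t ∈ Ioo (-(Real.pi / 6)) (Real.pi / 6)) :
    scorerMoment 0 z = scorerRay z (exp (t * I)) := by
  have hd : ∀ x ∈ Ioo (-(Real.pi / 6)) (Real.pi / 6),
      HasDerivAt (fun t : ℝ => scorerRay z (exp (t * I))) 0 x := fun x hx => by
    have h1 : HasDerivAt (fun t : ℝ => exp (t * I)) (exp (x * I) * I) x := by
      simpa using ((hasDerivAt_id (x : ℂ)).comp_ofReal.mul_const I).cexp
    simpa [Function.comp_def] using (hasDerivAt_scorerRay z (re_exp_mul_I_pow_three_pos hx)).comp x h1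
  have h := isOpen_Ioo.is_const_of_deriv_eq_zero isPreconnected_Ioo
    (fun x hx => (hd x hx).differentiableAt.differentiableWithinAt) (fun x hx => (hd x hx).deriv)
    (x := 0) (y := t) ⟨by linarith [Real.pi_pos], by linarith [Real.pi_pos]⟩ ht
  rw [← h]
  simp [scorerRay, scorerMoment]

/-- The cubic factor has modulus at most `1`; the linear exponential alone gives the bound. -/
lemma norm_scorerRay_le {z b : ℂ} (hb : 0 < (b ^ 3).re) (hzb : (z * b).re < 0) :
    ‖scorerRay z b‖ ≤ ‖b‖ / (-(z * b).re) := by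
  have h : ‖scorerRay z b‖ ≤ ∫ s in Ioi (0 : ℝ), ‖b‖ * Real.exp ((z * b).re * s) := by
    refine norm_integral_le_of_norm_le ?_ ?_
    · have := (exp_neg_integrableOn_Ioi 0 (neg_pos.2 hzb)).const_mul ‖b‖
      simpa using this
    · filter_upwards [ae_restrict_mem measurableSet_Ioi] with s hs
      have hs' : 0 < s := hs
      have h := norm_pow_mul_exp_cubic 0 b z hs'.le
      simp only [pow_zero, one_mul] at h
      rw [norm_mul, h]
      gcongr
      have : 0 ≤ (b ^ 3).re / 3 * s ^ 3 := by positivity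
      linarith
  rw [integral_const_mul, integral_exp_mul_Ioi hzb] at h
  refine h.trans (le_of_eq ?_)
  rw [mul_zero, Real.exp_zero, neg_div, ← div_neg, mul_one_div]

/-- In the sector `|arg (-z)| ≤ 2π/3 - δ` the integral `∫₀^∞ exp (-t³ / 3 + z t) dt` is `O(1/z)`. -/
lemma norm_scorerMoment_zero_le {δ : ℝ} (hδ : 0 < δ) : ∃ C : ℝ, 0 ≤ C ∧ ∀ z : ℂ, z ≠ 0 →
    |arg (-z)| ≤ 2 * Real.pi / 3 - δ → ‖scorerMoment 0 z‖ ≤ C * ‖z‖⁻¹ := by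
  have hpi := Real.pi_pos
  set η := min δ (Real.pi / 6)
  have hη : 0 < η := lt_min hδ (by positivity)
  have hη' : η ≤ Real.pi / 6 := min_le_right _ _
  have hηδ : η ≤ δ := min_le_left _ _
  have hsin : 0 < Real.sin (η / 2) := Real.sin_pos_of_pos_of_lt_pi (by linarith) (by linarith)
  refine ⟨(Real.sin (η / 2))⁻¹, by positivity, fun z hz harg => ?_⟩
  set φ := arg (-z)
  have hz' : z = -(‖z‖ * exp (φ * I)) := by
    have := norm_mul_exp_arg_mul_I (-z)
    rw [norm_neg] at this
    rw [this, neg_neg]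
  have hzn : 0 < ‖z‖ := norm_pos_iff.2 hz
  -- Rotating towards the axis by `π/6 - η/2` costs at most `2π/3 - δ - π/6 + η/2 ≤ π/2 - η/2`,
  -- since `η ≤ δ`; hence the constant `1 / sin (η/2)`.
  obtain ⟨t, ht, htφ⟩ : ∃ t ∈ Ioo (-(Real.pi / 6)) (Real.pi / 6),
      |φ + t| ≤ Real.pi / 2 - η / 2 := by
    rw [abs_le] at harg
    rcases le_total 0 φ with h | h
    · refine ⟨-(Real.pi / 6 - η / 2), ⟨by linarith, by linarith⟩, ?_⟩
      rw [abs_le]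
      constructor <;> linarith
    · refine ⟨Real.pi / 6 - η / 2, ⟨by linarith, by linarith⟩, ?_⟩
      rw [abs_le]
      constructor <;> linarith
  have hre : (z * exp (t * I)).re = -(‖z‖ * Real.cos (φ + t)) := by
    have : z * exp (t * I) = -(‖z‖ * exp ((φ + t : ℝ) * I)) := by
      nth_rw 1 [hz']
      push_cast
      rw [add_mul, Complex.exp_add]
      ring
    rw [this, neg_re, re_ofReal_mul, exp_ofReal_mul_I_re]
  have hcos : Real.sin (η / 2) ≤ Real.cos (φ + t) := by
    rw [← Real.cos_pi_div_two_sub, ← Real.cos_abs (φ + t)]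
    exact Real.cos_le_cos_of_nonneg_of_le_pi (abs_nonneg _) (by linarith) htφ
  have hneg : (z * exp (t * I)).re < 0 := by
    rw [hre, neg_lt_zero]
    exact mul_pos hzn (hsin.trans_le hcos)
  rw [scorerMoment_zero_eq_scorerRay z ht]
  refine (norm_scorerRay_le (re_exp_mul_I_pow_three_pos ht) hneg).trans ?_
  rw [hre, neg_neg, norm_exp_ofReal_mul_I, one_div, mul_inv, mul_comm]
  gcongr

end ScorerMoments

/-! ### Bounded solutions of the Airy equation on rays. -/

section RealAiryEquation

open Topology ComplexConjugate

/-- Taylor expansion over a unit step: `f1 s` is `f (s+1) - f s` up to an error controlled by `f2`.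
The factor `exp |κ|` is the largest change of the weight over that step. -/
lemma exists_norm_deriv_le_mul_exp {f f1 f2 : ℝ → ℂ} {C κ : ℝ}
    (hf : ∀ s, HasDerivAt f (f1 s) s) (hf1 : ∀ s, HasDerivAt f1 (f2 s) s)
    (h0 : ∀ s, 0 ≤ s → ‖f s‖ ≤ C * Real.exp (κ * s))
    (h2 : ∀ s, 0 ≤ s → ‖f2 s‖ ≤ C * Real.exp (κ * s)) :
    ∃ C' : ℝ, ∀ s, 0 ≤ s → ‖f1 s‖ ≤ C' * Real.exp (κ * s) := by
  have hC : 0 ≤ C := by simpa using (norm_nonneg _).trans (h0 0 le_rfl)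
  refine ⟨3 * (C * Real.exp |κ|), fun s hs => ?_⟩
  set K := C * Real.exp |κ| * Real.exp (κ * s)
  have hK : ∀ x ∈ Icc s (s + 1), C * Real.exp (κ * x) ≤ K := fun x hx => by
    simp only [K]
    rw [mul_assoc, ← Real.exp_add]
    have : κ * (x - s) ≤ |κ| := by
      have h1 : |κ| * (x - s) ≤ |κ| := mul_le_of_le_one_right (abs_nonneg _) (by linarith [hx.2])
      have h2 := mul_le_mul_of_nonneg_right (le_abs_self κ) (sub_nonneg.2 hx.1)
      linarith
    gcongr
    linarith
  have hK0 : 0 ≤ K := by positivity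
  have h3 : ∀ x ∈ Icc s (s + 1), ‖f1 x - f1 s‖ ≤ K := fun x hx => by
    refine (norm_image_sub_le_of_norm_deriv_le_segment' (C := K)
      (fun y _ => (hf1 y).hasDerivWithinAt) (fun y hy => ?_) x hx).trans
      (mul_le_of_le_one_right hK0 (by linarith [hx.2]))
    exact (h2 y (hs.trans hy.1)).trans (hK y (Ico_subset_Icc_self hy))
  have h4 := norm_image_sub_le_of_norm_deriv_le_segment' (C := K)
    (f := fun x : ℝ => f x - (x : ℂ) * f1 s) (f' := fun x => f1 x - f1 s)
    (fun y _ => ((hf y).sub (by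
      simpa using (hasDerivAt_id (y : ℂ)).comp_ofReal.mul_const (f1 s))).hasDerivWithinAt)
    (fun y hy => h3 y (Ico_subset_Icc_self hy)) (s + 1) ⟨by linarith, le_rfl⟩
  have h5 := (h0 (s + 1) (by linarith)).trans (hK (s + 1) ⟨by linarith, le_rfl⟩)
  have h6 := (h0 s hs).trans (hK s ⟨le_rfl, by linarith⟩)
  have h7 : f1 s = f (s + 1) - f s -
      ((f (s + 1) - ((s + 1 : ℝ) : ℂ) * f1 s) - (f s - (s : ℂ) * f1 s)) := by push_cast; ring
  have h8 : ‖f1 s‖ ≤ ‖f (s + 1)‖ + ‖f s‖ +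
      ‖(f (s + 1) - ((s + 1 : ℝ) : ℂ) * f1 s) - (f s - (s : ℂ) * f1 s)‖ := by
    nth_rw 1 [h7]
    exact (norm_sub_le _ _).trans (add_le_add_left (norm_sub_le _ _) _)
  calc ‖f1 s‖ ≤ K + K + K := by linarith
    _ = _ := by ring

lemma monotoneOn_of_hasDerivAt_nonneg {g g1 : ℝ → ℝ} {a : ℝ} (hg : ∀ s, HasDerivAt g (g1 s) s)
    (h : ∀ s, a ≤ s → 0 ≤ g1 s) : MonotoneOn g (Ici a) := by
  refine monotoneOn_of_deriv_nonneg (convex_Ici a)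
    (fun x _ => (hg x).continuousAt.continuousWithinAt)
    (fun x _ => (hg x).differentiableAt.differentiableWithinAt) fun x hx => ?_
  rw [interior_Ici] at hx
  rw [(hg x).deriv]
  exact h x (le_of_lt hx)

lemma false_of_linear_growth {g : ℝ → ℝ} {a B c : ℝ} (hc : 0 < c) (hB : ∀ s, a ≤ s → g s ≤ B)
    (hg : ∀ s, a ≤ s → g a + c * (s - a) ≤ g s) : False := by
  have h0 : 0 ≤ (B - g a) / c := div_nonneg (sub_nonneg.2 (hB a le_rfl)) hc.le
  have h1 := hg (a + ((B - g a) / c + 1)) (by linarith)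
  have h2 := hB (a + ((B - g a) / c + 1)) (by linarith)
  have h3 : c * ((B - g a) / c) = B - g a := mul_div_cancel₀ _ hc.ne'
  nlinarith

/-- `h` is convex and bounded, so `h' ≤ 0`. The function `(h' + mh) exp (-ms)` is nondecreasing, so
a positive value of `h' + mh` would force it to grow without bound; hence `h' + mh ≤ 0` and `h exp
(ms)` is nonincreasing. -/
lemma le_mul_exp_of_bounded_of_sq_mul_le {h h1 h2 : ℝ → ℝ} {a B m : ℝ} (hm : 0 < m)
    (hd : ∀ s, HasDerivAt h (h1 s) s) (hd1 : ∀ s, HasDerivAt h1 (h2 s) s)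
    (h0 : ∀ s, a ≤ s → 0 ≤ h s) (hB : ∀ s, a ≤ s → h s ≤ B)
    (hh : ∀ s, a ≤ s → m ^ 2 * h s ≤ h2 s) :
    ∀ s, a ≤ s → h s ≤ h a * Real.exp (-m * (s - a)) := by
  have hmono1 : MonotoneOn h1 (Ici a) := monotoneOn_of_hasDerivAt_nonneg hd1 fun s hs =>
    (mul_nonneg (sq_nonneg m) (h0 s hs)).trans (hh s hs)
  have hneg : ∀ s, a ≤ s → h1 s ≤ 0 := by
    intro x hx
    by_contra! hpos
    refine false_of_linear_growth (a := x) hpos (fun s hs => hB s (hx.trans hs)) fun s hs => ?_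
    have := monotoneOn_of_hasDerivAt_nonneg (a := x) (g := fun s => h s - h1 x * s)
      (fun s => (hd s).sub (by simpa using (hasDerivAt_id s).const_mul (h1 x)))
      (fun s hs => sub_nonneg.2 (hmono1 hx (hx.trans hs) hs)) self_mem_Ici hs hs
    simp only at this
    linarith
  have hexp : ∀ (k s : ℝ), HasDerivAt (fun s => Real.exp (k * s)) (Real.exp (k * s) * k) s :=
    fun k s => by simpa using ((hasDerivAt_id s).const_mul k).exp
  have hg : ∀ s, a ≤ s → h1 s + m * h s ≤ 0 := by
    intro x hx
    by_contra! hpos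
    refine false_of_linear_growth (g := fun s => h1 s + m * h s) (a := x) (B := m * B)
      (mul_pos hm hpos) (fun s hs => ?_) fun s hs => ?_
    · have := mul_le_mul_of_nonneg_left (hB s (hx.trans hs)) hm.le
      linarith [hneg s (hx.trans hs)]
    · have := monotoneOn_of_hasDerivAt_nonneg (a := x)
        (fun s => ((hd1 s).add ((hd s).const_mul m)).mul (hexp (-m) s)) (fun s hs => ?_)
        self_mem_Ici hs hs
      · simp only [Pi.add_apply, Pi.mul_apply] at this
        have h3 : (h1 x + m * h x) * Real.exp (m * (s - x)) ≤ h1 s + m * h s := by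
          have := mul_le_mul_of_nonneg_right this (Real.exp_pos (m * s)).le
          rw [mul_assoc, mul_assoc, ← Real.exp_add, ← Real.exp_add] at this
          rwa [show -m * s + m * s = 0 by ring, Real.exp_zero, mul_one,
            show -m * x + m * s = m * (s - x) by ring] at this
        have h4 := Real.add_one_le_exp (m * (s - x))
        nlinarith
      · have h5 := hh s (hx.trans hs)
        have : 0 ≤ (h2 s - m ^ 2 * h s) * Real.exp (-m * s) :=
          mul_nonneg (sub_nonneg.2 h5) (Real.exp_pos _).le
        simp only [Pi.add_apply]
        linarith
  intro s hs
  have := monotoneOn_of_hasDerivAt_nonneg (a := a) (fun s => ((hd s).mul (hexp m s)).neg)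
    (fun s hs => ?_) self_mem_Ici hs hs
  · simp only [Pi.neg_apply, Pi.mul_apply] at this
    have h3 := mul_le_mul_of_nonneg_right (neg_le_neg_iff.1 this) (Real.exp_pos (-m * s)).le
    rw [mul_assoc, mul_assoc, ← Real.exp_add, ← Real.exp_add] at h3
    rwa [show m * s + -m * s = 0 by ring, Real.exp_zero, mul_one,
      show m * a + -m * s = -m * (s - a) by ring] at h3
  · have := mul_nonneg (neg_nonneg.2 (hg s hs)) (Real.exp_pos (m * s)).le
    linarith

lemma hasDerivAt_conj_mul {f f1 f2 : ℝ → ℂ} (hf : ∀ s, HasDerivAt f (f1 s) s)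
    (hf1 : ∀ s, HasDerivAt f1 (f2 s) s) (s : ℝ) :
    HasDerivAt (fun s => conj (f s) * f1 s) (((‖f1 s‖ ^ 2 : ℝ) : ℂ) + conj (f s) * f2 s) s := by
  refine ((hf s).star.mul (hf1 s)).congr_deriv ?_
  simp only [star_def]
  rw [conj_mul']
  push_cast
  rfl

/-- Bounded solutions of `f'' = a s f` on the positive half-line decay, with their derivative,
faster than every exponential. -/
lemma exists_norm_le_mul_exp_of_bounded {f f1 : ℝ → ℂ} {a C : ℝ} (ha : 0 < a)
    (hf : ∀ s, HasDerivAt f (f1 s) s) (hf1 : ∀ s : ℝ, HasDerivAt f1 (a * s * f s) s)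
    (hC : ∀ s, 0 ≤ s → ‖f s‖ ≤ C) {κ : ℝ} (hκ : 0 < κ) :
    ∃ C' : ℝ, ∀ s, 0 ≤ s → ‖f s‖ ≤ C' * Real.exp (-κ * s) ∧ ‖f1 s‖ ≤ C' * Real.exp (-κ * s) := by
  have hC0 : 0 ≤ C := (norm_nonneg _).trans (hC 0 le_rfl)
  have key : ∀ κ : ℝ, 0 < κ → ∃ C' : ℝ, 0 ≤ C' ∧ ∀ s, 0 ≤ s → ‖f s‖ ≤ C' * Real.exp (-κ * s) := by
    intro κ hκ
    -- Beyond `b` one has `as ≥ 2κ²`, so `(|f|²)'' = 2|f'|² + 2as|f|² ≥ (2κ)² |f|²`.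
    set b := 2 * κ ^ 2 / a
    have hb : 0 ≤ b := by positivity
    refine ⟨C * Real.exp (κ * b), by positivity, fun s hs => ?_⟩
    rw [mul_assoc, ← Real.exp_add]
    rcases le_total s b with hsb | hsb
    · refine (hC s hs).trans (le_mul_of_one_le_right hC0 (Real.one_le_exp ?_))
      nlinarith
    have hre := fun s => (hasDerivAt_conj_mul hf hf1 s)
    have h := le_mul_exp_of_bounded_of_sq_mul_le (h := fun s => ‖f s‖ ^ 2)
      (h1 := fun s => 2 * (conj (f s) * f1 s).re)
      (h2 := fun s => 2 * (((‖f1 s‖ ^ 2 : ℝ) : ℂ) + conj (f s) * (a * s * f s)).re)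
      (a := b) (B := C ^ 2) (m := 2 * κ) (by positivity)
      (fun s => by simpa [Complex.inner, mul_comm] using (hf s).norm_sq)
      (fun s => (reCLM.hasFDerivAt.comp_hasDerivAt s (hre s)).const_mul 2)
      (fun s _ => by positivity) (fun s hs => by gcongr; exact hC s (hb.trans hs))
      (fun s hs => ?_) s hsb
    · have h' : ‖f s‖ ^ 2 ≤ (C * Real.exp (κ * b + -κ * s)) ^ 2 := by
        refine h.trans ?_
        rw [mul_pow, ← Real.exp_nat_mul]
        refine mul_le_mul (pow_le_pow_left₀ (norm_nonneg _) (hC b hb) 2)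
          (Real.exp_le_exp.2 ?_) (Real.exp_pos _).le (by positivity)
        push_cast
        linarith
      exact (pow_le_pow_iff_left₀ (norm_nonneg _) (by positivity) two_ne_zero).1 h'
    · have e : conj (f s) * (a * s * f s) = ((a * s * ‖f s‖ ^ 2 : ℝ) : ℂ) := by
        push_cast
        rw [← conj_mul']
        ring
      rw [e, ← ofReal_add, ofReal_re]
      have h1 : 2 * κ ^ 2 ≤ s * a := (div_le_iff₀ ha).1 hs
      nlinarith [sq_nonneg ‖f1 s‖, mul_le_mul_of_nonneg_right h1 (sq_nonneg ‖f s‖)]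
  obtain ⟨C1, hC1, h1⟩ := key κ hκ
  -- The extra unit of decay absorbs the factor `s` in `f'' = a s f`.
  obtain ⟨C2, hC2, h2⟩ := key (κ + 1) (by positivity)
  obtain ⟨C3, h3⟩ := exists_norm_deriv_le_mul_exp (C := max C1 (a * C2)) (κ := -κ) hf hf1
    (fun s hs => (h1 s hs).trans (by gcongr; exact le_max_left _ _)) (fun s hs => by
      have e : ‖(a : ℂ) * s * f s‖ = a * s * ‖f s‖ := by
        rw [norm_mul, norm_mul, norm_real, norm_real, Real.norm_of_nonneg ha.le,
          Real.norm_of_nonneg hs]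
      rw [e]
      have h4 : s * Real.exp (-(κ + 1) * s) ≤ Real.exp (-κ * s) := by
        have h5 : s ≤ Real.exp s := by linarith [Real.add_one_le_exp s]
        calc _ ≤ Real.exp s * Real.exp (-(κ + 1) * s) := by gcongr
          _ = _ := by rw [← Real.exp_add]; ring_nf
      calc a * s * ‖f s‖ ≤ a * s * (C2 * Real.exp (-(κ + 1) * s)) := by
            gcongr; exact h2 s hs
        _ = a * C2 * (s * Real.exp (-(κ + 1) * s)) := by ring
        _ ≤ a * C2 * Real.exp (-κ * s) := by gcongr
        _ ≤ _ := by gcongr; exact le_max_right _ _)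
  refine ⟨max C1 C3, fun s hs => ⟨(h1 s hs).trans ?_, (h3 s hs).trans ?_⟩⟩
  · gcongr; exact le_max_left _ _
  · gcongr; exact le_max_right _ _

lemma tendsto_mul_exp_neg (C : ℝ) {κ : ℝ} (hκ : 0 < κ) :
    Tendsto (fun s : ℝ => C * Real.exp (-κ * s)) atTop (𝓝 0) := by
  simpa using (Real.tendsto_exp_atBot.comp
    (tendsto_id.const_mul_atTop_of_neg (neg_lt_zero.2 hκ))).const_mul C

/-- The energy identity for bounded solutions of `f'' = a s f` on the positive half-line. -/
lemma conj_mul_deriv_zero_of_bounded {f f1 : ℝ → ℂ} {a C : ℝ} (ha : 0 < a)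
    (hf : ∀ s, HasDerivAt f (f1 s) s) (hf1 : ∀ s : ℝ, HasDerivAt f1 (a * s * f s) s)
    (hC : ∀ s, 0 ≤ s → ‖f s‖ ≤ C) :
    (∃ x : ℝ, 0 ≤ x ∧ conj (f 0) * f1 0 = -x) ∧
      (conj (f 0) * f1 0 = 0 → ∀ s, 0 < s → f s = 0) := by
  -- The derivative of `conj f * f'` is `|f'|² + as|f|²`, real and nonnegative for `s ≥ 0`, and the
  -- product tends to `0`. So its imaginary part is identically `0` and its real part increases to
  -- `0`.
  have hF := hasDerivAt_conj_mul hf hf1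
  have e : ∀ s : ℝ, ((‖f1 s‖ ^ 2 : ℝ) : ℂ) + conj (f s) * (a * s * f s) =
      ((‖f1 s‖ ^ 2 + a * s * ‖f s‖ ^ 2 : ℝ) : ℂ) := fun s => by
    push_cast
    rw [← conj_mul' (f s)]
    ring
  simp only [e] at hF
  have hlim : Tendsto (fun s => conj (f s) * f1 s) atTop (𝓝 0) := by
    obtain ⟨C', hC'⟩ := exists_norm_le_mul_exp_of_bounded ha hf hf1 hC one_pos
    have h0 := tendsto_mul_exp_neg C' one_pos
    have h00 := h0.mul h0
    rw [mul_zero] at h00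
    refine squeeze_zero_norm' ?_ h00
    filter_upwards [eventually_ge_atTop 0] with s hs
    rw [norm_mul, RCLike.norm_conj]
    exact mul_le_mul (hC' s hs).1 (hC' s hs).2 (norm_nonneg _)
      ((norm_nonneg _).trans (hC' s hs).1)
  have hre : ∀ s, HasDerivAt (fun s => (conj (f s) * f1 s).re)
      (‖f1 s‖ ^ 2 + a * s * ‖f s‖ ^ 2) s := fun s => by
    have := reCLM.hasFDerivAt.comp_hasDerivAt s (hF s)
    rwa [reCLM_apply, ofReal_re] at this
  have him : ∀ s, HasDerivAt (fun s => (conj (f s) * f1 s).im) 0 s := fun s => by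
    have := imCLM.hasFDerivAt.comp_hasDerivAt s (hF s)
    rwa [imCLM_apply, ofReal_im] at this
  have him0 : (conj (f 0) * f1 0).im = 0 := by
    have h1 : ∀ s, (conj (f s) * f1 s).im = (conj (f 0) * f1 0).im := fun s =>
      is_const_of_deriv_eq_zero (fun s => (him s).differentiableAt) (fun s => (him s).deriv) s 0
    have h2 : Tendsto (fun s => (conj (f s) * f1 s).im) atTop (𝓝 0) :=
      (continuous_im.tendsto 0).comp hlim
    simp only [h1] at h2
    exact tendsto_nhds_unique tendsto_const_nhds h2
  have hmono := monotoneOn_of_hasDerivAt_nonneg (a := 0) hre fun s hs => by positivity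
  have hnonpos : ∀ s, 0 ≤ s → (conj (f s) * f1 s).re ≤ 0 := fun s hs => by
    have h2 : Tendsto (fun s => (conj (f s) * f1 s).re) atTop (𝓝 0) :=
      (continuous_re.tendsto 0).comp hlim
    refine ge_of_tendsto h2 ?_
    filter_upwards [eventually_ge_atTop s] with x hx
    exact hmono hs (hs.trans hx) hx
  refine ⟨⟨-(conj (f 0) * f1 0).re, neg_nonneg.2 (hnonpos 0 le_rfl), ?_⟩, fun h s hs => ?_⟩
  · apply Complex.ext
    · simp
    · rw [him0]; simp
  -- A zero value at `0` squeezes the monotone real part to `0`, so its derivative vanishes, and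
  -- with it `f`.
  · have hz : ∀ x, 0 ≤ x → (conj (f x) * f1 x).re = 0 := fun x hx => by
      refine le_antisymm (hnonpos x hx) ?_
      have := hmono self_mem_Ici hx hx
      simpa [h] using this
    have hd : ‖f1 s‖ ^ 2 + a * s * ‖f s‖ ^ 2 = 0 := by
      refine (hre s).unique (HasDerivAt.congr_of_eventuallyEq (hasDerivAt_const s (0 : ℝ)) ?_)
      filter_upwards [lt_mem_nhds hs] with x hx
      exact hz x hx.le
    have h1 : a * s * ‖f s‖ ^ 2 = 0 :=
      le_antisymm (by linarith [sq_nonneg ‖f1 s‖]) (by positivity)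
    have h2 : ‖f s‖ ^ 2 = 0 := (mul_eq_zero.1 h1).resolve_left (by positivity)
    simpa using h2

lemma hasDerivAt_comp_ofReal_mul {g : ℂ → ℂ} (hg : Differentiable ℂ g) (v : ℂ) (s : ℝ) :
    HasDerivAt (fun s : ℝ => g (s * v)) (v * deriv g (s * v)) s := by
  have h : HasDerivAt (fun s : ℝ => (s : ℂ) * v) v s := by
    simpa using (hasDerivAt_id (s : ℂ)).comp_ofReal.mul_const v
  rw [mul_comm]
  exact (hg _).hasDerivAt.comp s h

lemma hasDerivAt_deriv_comp_ofReal_mul {g : ℂ → ℂ} (hg : Differentiable ℂ g) (v : ℂ) (s : ℝ) :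
    HasDerivAt (fun s : ℝ => v * deriv g (s * v)) (v ^ 2 * deriv (deriv g) (s * v)) s := by
  refine ((hasDerivAt_comp_ofReal_mul hg.deriv v s).const_mul v).congr_deriv ?_
  ring

/-- An entire solution of `g'' = a z g` that is bounded on two of the three rays through the cube
roots of unity vanishes. -/
lemma eq_zero_of_bounded_on_rays {g : ℂ → ℂ} {a : ℝ} (ha : 0 < a) (hg : Differentiable ℂ g)
    (hode : ∀ z, deriv (deriv g) z = a * z * g z) {v v' : ℂ} (hv : v ^ 3 = 1) (hv' : v' ^ 3 = 1)
    (hne : v ≠ v') {C C' : ℝ} (hC : ∀ s : ℝ, 0 ≤ s → ‖g (s * v)‖ ≤ C)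
    (hC' : ∀ s : ℝ, 0 ≤ s → ‖g (s * v')‖ ≤ C') : g = 0 := by
  have hnorm : ∀ v : ℂ, v ^ 3 = 1 → ‖v‖ = 1 := fun v hv => by
    have : ‖v‖ ^ 3 = 1 := by rw [← norm_pow, hv, norm_one]
    exact (pow_eq_one_iff_of_nonneg (norm_nonneg v) three_ne_zero).1 this
  -- Because `v³ = 1`, the restriction `s ↦ g (s v)` solves the real equation `f'' = a s f`, with
  -- `f' 0 = v * g' 0`.
  have main : ∀ v : ℂ, v ^ 3 = 1 → ∀ C : ℝ, (∀ s : ℝ, 0 ≤ s → ‖g (s * v)‖ ≤ C) →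
      (∃ x : ℝ, 0 ≤ x ∧ v * (conj (g 0) * deriv g 0) = -x) ∧
        (conj (g 0) * deriv g 0 = 0 → g = 0) := by
    intro v hv C hC
    have hv0 : v ≠ 0 := by rintro rfl; simp at hv
    obtain ⟨h1, h2⟩ := conj_mul_deriv_zero_of_bounded ha (hasDerivAt_comp_ofReal_mul hg v)
      (fun s => (hasDerivAt_deriv_comp_ofReal_mul hg v s).congr_deriv (by
        rw [hode]
        linear_combination ((a : ℂ) * s * g (s * v)) * hv)) hC
    simp only [ofReal_zero, zero_mul] at h1 h2
    refine ⟨by simpa only [mul_left_comm] using h1, fun h => ?_⟩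
    have h3 := h2 (by rw [mul_left_comm, h, mul_zero])
    refine AnalyticOnNhd.eq_of_frequently_eq (z₀ := 0)
      (fun z _ => hg.analyticAt z) analyticOnNhd_const ?_
    have ht : Tendsto (fun s : ℝ => (s : ℂ) * v) (𝓝[>] 0) (𝓝[≠] 0) := by
      refine tendsto_nhdsWithin_iff.2 ⟨?_, ?_⟩
      · have : Continuous fun s : ℝ => (s : ℂ) * v := by fun_prop
        simpa using (this.tendsto 0).mono_left nhdsWithin_le_nhds
      · filter_upwards [self_mem_nhdsWithin] with s hs
        have hs' : (s : ℂ) ≠ 0 := ofReal_ne_zero.2 (ne_of_gt hs)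
        exact mul_ne_zero hs' hv0
    refine ht.frequently (Eventually.frequently ?_)
    filter_upwards [self_mem_nhdsWithin] with s hs
    exact h3 s hs
  obtain ⟨⟨x, hx, hvx⟩, h0⟩ := main v hv C hC
  obtain ⟨⟨y, hy, hvy⟩, -⟩ := main v' hv' C' hC'
  refine h0 ?_
  by_contra hP
  set P := conj (g 0) * deriv g 0
  -- Taking moduli gives `x = y`; as `v ≠ v'`, both are `0`.
  have h1 : v * y = v' * x := by
    apply mul_right_cancel₀ hP
    linear_combination (y : ℂ) * hvx - (x : ℂ) * hvy
  have hxy : y = x := by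
    have := congrArg norm h1
    rwa [norm_mul, norm_mul, hnorm v hv, hnorm v' hv', one_mul, one_mul, norm_real, norm_real,
      Real.norm_of_nonneg hx, Real.norm_of_nonneg hy] at this
  rw [hxy] at h1
  rcases mul_eq_mul_right_iff.1 h1 with h | h
  · exact hne h
  · rw [h, neg_zero] at hvx
    rcases mul_eq_zero.1 hvx with h' | h'
    · rw [h'] at hv; simp at hv
    · exact hP h'

end RealAiryEquation

/-! ### The Airy function as a combination of Scorer moments. -/

section AiryFromScorer

open Topology

lemma exp_two_pi_I_int_div_three (n : ℤ) :
    exp (2 * Real.pi * I * n / 3) = exp (2 * Real.pi * I / 3) ^ n := by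
  rw [← exp_int_mul]; ring_nf

/-- The primitive cube root of unity `e^{2πi/3}`. -/
noncomputable def cubeRoot : ℂ := exp (2 * Real.pi * I / 3)

lemma isPrimitiveRoot_cubeRoot : IsPrimitiveRoot cubeRoot 3 := by
  have := isPrimitiveRoot_exp 3 three_ne_zero
  push_cast at this
  exact this

lemma cubeRoot_pow_three : cubeRoot ^ 3 = 1 := isPrimitiveRoot_cubeRoot.pow_eq_one

lemma cubeRoot_ne_zero : cubeRoot ≠ 0 := exp_ne_zero _

lemma one_add_cubeRoot_add_sq : 1 + cubeRoot + cubeRoot ^ 2 = 0 := by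
  have := isPrimitiveRoot_cubeRoot.geom_sum_eq_zero (by norm_num)
  simpa [Finset.sum_range_succ] using this

lemma cubeRoot_zpow_pow_three (n : ℤ) : (cubeRoot ^ n) ^ 3 = 1 := by
  rw [← zpow_natCast, ← zpow_mul, mul_comm, zpow_mul, zpow_natCast, cubeRoot_pow_three, one_zpow]

lemma cubeRoot_zpow_ne_one {n : ℤ} (hn : ¬ (3 : ℤ) ∣ n) : cubeRoot ^ n ≠ 1 := fun h =>
  hn ((isPrimitiveRoot_cubeRoot.zpow_eq_one_iff_dvd n).1 h)

lemma norm_cubeRoot_zpow (n : ℤ) : ‖cubeRoot ^ n‖ = 1 := by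
  have : ‖cubeRoot ^ n‖ ^ 3 = 1 := by rw [← norm_pow, cubeRoot_zpow_pow_three, norm_one]
  exact (pow_eq_one_iff_of_nonneg (norm_nonneg _) three_ne_zero).1 this

lemma exp_pi_I_div_three : exp (Real.pi * I / 3) = -cubeRoot ^ 2 := by
  rw [cubeRoot, ← Complex.exp_nat_mul, neg_eq_neg_one_mul, ← exp_neg_pi_mul_I, ← Complex.exp_add]
  congr 1
  push_cast
  ring

lemma exp_neg_pi_I_div_three : exp (-(Real.pi * I / 3)) = -cubeRoot := by
  rw [cubeRoot, neg_eq_neg_one_mul (exp _), ← exp_neg_pi_mul_I, ← Complex.exp_add]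
  congr 1
  ring

lemma eq_cubeRoot_or_of_pow_three {v : ℂ} (hv : v ^ 3 = 1) (hv1 : v ≠ 1) :
    v = cubeRoot ∨ v = cubeRoot ^ 2 := by
  have h : (v - 1) * ((v - cubeRoot) * (v - cubeRoot ^ 2)) = 0 := by
    linear_combination hv - cubeRoot_pow_three -
      (v ^ 2 - v) * one_add_cubeRoot_add_sq + v * cubeRoot_pow_three
  rcases mul_eq_zero.1 h with h | h
  · exact absurd (sub_eq_zero.1 h) hv1
  · rcases mul_eq_zero.1 h with h | h
    · exact Or.inl (sub_eq_zero.1 h)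
    · exact Or.inr (sub_eq_zero.1 h)

lemma abs_arg_neg_of_pow_three {v : ℂ} (hv : v ^ 3 = 1) (hv1 : v ≠ 1) :
    |arg (-v)| = Real.pi / 3 := by
  have hpi := Real.pi_pos
  rcases eq_cubeRoot_or_of_pow_three hv hv1 with rfl | rfl
  · rw [← exp_neg_pi_I_div_three, arg_exp]
    have : (-(Real.pi * I / 3)).im = -(Real.pi / 3) := by simp
    rw [this, (toIocMod_eq_self _).2 ⟨by linarith, by linarith⟩, abs_neg,
      abs_of_pos (by positivity)]
  · rw [← exp_pi_I_div_three, arg_exp]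
    have : (Real.pi * I / 3).im = Real.pi / 3 := by simp
    rw [this, (toIocMod_eq_self _).2 ⟨by linarith, by linarith⟩, abs_of_pos (by positivity)]

lemma differentiable_scorerMoment (n : ℕ) : Differentiable ℂ (scorerMoment n) := fun z =>
  (hasDerivAt_scorerMoment n z).differentiableAt

lemma deriv_scorerMoment (n : ℕ) : deriv (scorerMoment n) = scorerMoment (n + 1) :=
  funext fun z => (hasDerivAt_scorerMoment n z).deriv

lemma deriv_deriv_comp_mul_left {F : ℂ → ℂ} (a z : ℂ) :
    deriv (deriv fun t => F (a * t)) z = a ^ 2 * deriv (deriv F) (a * z) := by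
  have : (deriv fun t => F (a * t)) = fun t => a * deriv F (a * t) :=
    funext fun t => deriv_comp_mul_left a F t
  rw [this, deriv_const_mul_field, deriv_comp_mul_left]
  simp only [smul_eq_mul]
  ring

lemma exists_norm_le_of_continuous {f : ℝ → ℂ} (hf : Continuous f) {C a : ℝ}
    (h : ∀ s, a ≤ s → ‖f s‖ ≤ C) : ∃ C' : ℝ, ∀ s, 0 ≤ s → ‖f s‖ ≤ C' := by
  obtain ⟨B, hB⟩ := (isCompact_Icc (a := 0) (b := a)).exists_bound_of_continuousOn hf.continuousOn
  refine ⟨max B C, fun s hs => ?_⟩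
  rcases le_total s a with hs1 | hs1
  · exact (hB s ⟨hs, hs1⟩).trans (le_max_left _ _)
  · exact (h s hs1).trans (le_max_right _ _)

lemma exists_norm_scorerMoment_zero_le_on_ray {v : ℂ} (hv : v ^ 3 = 1) (hv1 : v ≠ 1) :
    ∃ C : ℝ, ∀ s : ℝ, 0 ≤ s → ‖scorerMoment 0 (s * v)‖ ≤ C := by
  have hpi := Real.pi_pos
  -- With this `δ` the sector is `|arg (-z)| ≤ π/3`, whose edges are the two rays in question.
  obtain ⟨C, hC, h⟩ := norm_scorerMoment_zero_le (δ := Real.pi / 3) (by positivity)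
  have hv0 : v ≠ 0 := by rintro rfl; simp at hv
  have hvn : ‖v‖ = 1 := by
    have : ‖v‖ ^ 3 = 1 := by rw [← norm_pow, hv, norm_one]
    exact (pow_eq_one_iff_of_nonneg (norm_nonneg v) three_ne_zero).1 this
  have hc : Continuous fun s : ℝ => scorerMoment 0 (s * v) :=
    (differentiable_scorerMoment 0).continuous.comp (by fun_prop)
  refine exists_norm_le_of_continuous hc (a := 1) (C := C) fun s hs => ?_
  have hs0 : 0 < s := by linarith
  refine (h _ (mul_ne_zero (ofReal_ne_zero.2 hs0.ne') hv0) ?_).trans ?_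
  · rw [← mul_neg, arg_real_mul _ hs0, abs_arg_neg_of_pow_three hv hv1]
    linarith
  · rw [norm_mul, hvn, norm_real, Real.norm_of_nonneg hs0.le, mul_one]
    exact mul_le_of_le_one_right hC (inv_le_one_of_one_le₀ hs)

/-- The contour directions are `e^{πi/3} = -ω²` and `e^{-πi/3} = -ω` with `ω = cubeRoot`, so each
ray integral is a Scorer moment at a rotated argument. -/
lemma airyAi_eq (z : ℂ) : airyAi z = (2 * Real.pi * I)⁻¹ *
    (cubeRoot * scorerMoment 0 (cubeRoot * z) -
      cubeRoot ^ 2 * scorerMoment 0 (cubeRoot ^ 2 * z)) := by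
  rw [airyAi, exp_pi_I_div_three, exp_neg_pi_I_div_three, integral_mul_const, integral_mul_const,
    scorerMoment, scorerMoment]
  have e1 : ∀ s : ℝ, exp (-(s : ℂ) ^ 3 / 3 - z * (s * -cubeRoot ^ 2)) =
      (s : ℂ) ^ 0 * exp (-(s : ℂ) ^ 3 / 3 + cubeRoot ^ 2 * z * s) := fun s => by
    rw [pow_zero, one_mul]; ring_nf
  have e2 : ∀ s : ℝ, exp (-(s : ℂ) ^ 3 / 3 - z * (s * -cubeRoot)) =
      (s : ℂ) ^ 0 * exp (-(s : ℂ) ^ 3 / 3 + cubeRoot * z * s) := fun s => by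
    rw [pow_zero, one_mul]; ring_nf
  simp only [e1, e2]
  ring

lemma hasDerivAt_airyAi (z : ℂ) : HasDerivAt airyAi ((2 * Real.pi * I)⁻¹ *
    (cubeRoot ^ 2 * scorerMoment 1 (cubeRoot * z) -
      cubeRoot ^ 4 * scorerMoment 1 (cubeRoot ^ 2 * z))) z := by
  rw [show airyAi = _ from funext airyAi_eq]
  have h : ∀ a : ℂ, HasDerivAt (fun z => scorerMoment 0 (a * z)) (scorerMoment 1 (a * z) * a) z :=
    fun a => (hasDerivAt_scorerMoment 0 (a * z)).comp z (hasDerivAt_const_mul a)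
  refine ((((h _).const_mul _).sub ((h _).const_mul _)).const_mul _).congr_deriv ?_
  ring

lemma differentiable_airyAi : Differentiable ℂ airyAi := fun z =>
  (hasDerivAt_airyAi z).differentiableAt

lemma deriv_deriv_airyAi (z : ℂ) : deriv (deriv airyAi) z = z * airyAi z := by
  rw [show deriv airyAi = _ from funext fun z => (hasDerivAt_airyAi z).deriv, airyAi_eq]
  have h : ∀ a : ℂ, HasDerivAt (fun z => scorerMoment 1 (a * z))
      ((a * z * scorerMoment 0 (a * z) + 1) * a) z := fun a => by
    rw [← scorerMoment_two]
    exact (hasDerivAt_scorerMoment 1 (a * z)).comp z (hasDerivAt_const_mul a)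
  refine (HasDerivAt.congr_deriv
    ((((h _).const_mul _).sub ((h _).const_mul _)).const_mul _) ?_).deriv
  have h3 := cubeRoot_pow_three
  linear_combination (2 * Real.pi * I)⁻¹ * (z * cubeRoot * scorerMoment 0 (cubeRoot * z) -
    z * cubeRoot ^ 2 * scorerMoment 0 (cubeRoot ^ 2 * z) * (cubeRoot ^ 3 + 1) -
    cubeRoot ^ 3) * h3

lemma exists_norm_airyAi_le : ∃ C : ℝ, ∀ s : ℝ, 0 ≤ s → ‖airyAi s‖ ≤ C := by
  have h1 : cubeRoot ≠ 1 := by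
    simpa using cubeRoot_zpow_ne_one (n := 1) (by norm_num)
  have h2 : cubeRoot ^ 2 ≠ 1 := by
    have := cubeRoot_zpow_ne_one (n := 2) (by norm_num)
    exact_mod_cast this
  have h3 : (cubeRoot ^ 2) ^ 3 = 1 := by rw [← pow_mul, mul_comm, pow_mul, cubeRoot_pow_three,
    one_pow]
  obtain ⟨C1, hC1⟩ := exists_norm_scorerMoment_zero_le_on_ray cubeRoot_pow_three h1
  obtain ⟨C2, hC2⟩ := exists_norm_scorerMoment_zero_le_on_ray h3 h2
  refine ⟨‖(2 * Real.pi * I)⁻¹‖ * (‖cubeRoot‖ * C1 + ‖cubeRoot ^ 2‖ * C2), fun s hs => ?_⟩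
  rw [airyAi_eq, norm_mul, mul_comm cubeRoot (s : ℂ), mul_comm (cubeRoot ^ 2) (s : ℂ)]
  gcongr
  refine (norm_sub_le _ _).trans ?_
  rw [norm_mul, norm_mul]
  gcongr
  · exact hC1 s hs
  · exact hC2 s hs

lemma scorerMoment_apply_zero (n : ℕ) : scorerMoment n 0 =
    (((1 / 3 : ℝ) ^ (-((n : ℝ) + 1) / 3) * (1 / 3) * Real.Gamma (((n : ℝ) + 1) / 3) : ℝ) : ℂ) := by
  rw [← integral_rpow_mul_exp_neg_mul_rpow three_pos (by have := n.cast_nonneg (α := ℝ); linarith)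
    (by norm_num), ← integral_complex_ofReal, scorerMoment]
  refine integral_congr_ae (Eventually.of_forall fun s => ?_)
  have h3 : s ^ (3 : ℝ) = s ^ 3 := by rw [← Real.rpow_natCast]; norm_num
  simp only [h3, Real.rpow_natCast, zero_mul, add_zero]
  push_cast
  ring_nf

/-- Only the product is needed, so the reflection formula for `Γ(1/3) Γ(2/3)` suffices. -/
lemma scorerMoment_zero_mul_one : scorerMoment 0 0 * scorerMoment 1 0 =
    ((2 * Real.pi / (3 * Real.sqrt 3) : ℝ) : ℂ) := by
  rw [scorerMoment_apply_zero, scorerMoment_apply_zero, ← ofReal_mul]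
  congr 1
  have hG := Real.Gamma_mul_Gamma_one_sub (1 / 3)
  rw [show (1 : ℝ) - 1 / 3 = 2 / 3 by norm_num, show Real.pi * (1 / 3) = Real.pi / 3 by ring,
    Real.sin_pi_div_three] at hG
  have hp : (1 / 3 : ℝ) ^ (-(1 / 3) : ℝ) * (1 / 3 : ℝ) ^ (-(2 / 3) : ℝ) = 3 := by
    rw [← Real.rpow_add (by norm_num)]
    norm_num
  norm_num at hG hp ⊢
  have h3 : Real.sqrt 3 ≠ 0 := by positivity
  calc _ = ((1 / 3 : ℝ) ^ (-(1 / 3) : ℝ) * (1 / 3 : ℝ) ^ (-(2 / 3) : ℝ)) * (1 / 9) *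
      (Real.Gamma (1 / 3) * Real.Gamma (2 / 3)) := by ring_nf
    _ = _ := by
      norm_num
      rw [hp, hG]
      field_simp
      norm_num

lemma airyAi_zero_mul_deriv : airyAi 0 * deriv airyAi 0 =
    -((1 / (2 * Real.pi * Real.sqrt 3) : ℝ) : ℂ) := by
  rw [(hasDerivAt_airyAi 0).deriv, airyAi_eq]
  simp only [mul_zero]
  have h3 := cubeRoot_pow_three
  have h1 := one_add_cubeRoot_add_sq
  have h4 : cubeRoot ^ 4 = cubeRoot := by linear_combination cubeRoot * h3
  have hs : (cubeRoot - cubeRoot ^ 2) * (cubeRoot ^ 2 - cubeRoot ^ 4) = 3 := by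
    linear_combination (2 - cubeRoot - cubeRoot ^ 2 + cubeRoot ^ 3) * h3 - h1
  have hI : (2 * (Real.pi : ℂ) * I)⁻¹ * (2 * Real.pi * I)⁻¹ = -(4 * (Real.pi : ℂ) ^ 2)⁻¹ := by
    rw [← mul_inv, ← inv_neg]
    congr 1
    linear_combination 4 * (Real.pi : ℂ) ^ 2 * I_sq
  calc _ = ((2 * (Real.pi : ℂ) * I)⁻¹ * (2 * Real.pi * I)⁻¹) *
        ((cubeRoot - cubeRoot ^ 2) * (cubeRoot ^ 2 - cubeRoot ^ 4)) *
        (scorerMoment 0 0 * scorerMoment 1 0) := by ring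
    _ = _ := by
      rw [hI, hs, scorerMoment_zero_mul_one]
      have hpi : (Real.pi : ℂ) ≠ 0 := ofReal_ne_zero.2 Real.pi_ne_zero
      have hsq : ((Real.sqrt 3 : ℝ) : ℂ) ≠ 0 := ofReal_ne_zero.2 (by positivity)
      push_cast
      field_simp
      norm_num

/-- The two terms are `i e^{±iπ(k-j)/3}`, with difference `-2 sin (π(k-j)/3)`; the sine is the same
for `k - j = 1` and `2`. -/
lemma exp_mul_cubeRoot_sub {j k : ℤ} (hjk : k - j = 1 ∨ k - j = 2) :
    exp (Real.pi * I / 2 + Real.pi * I * (j + k) / 3) * (cubeRoot ^ (-j) - cubeRoot ^ (-k)) =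
      -((Real.sqrt 3 : ℝ) : ℂ) := by
  have hsin : Real.sin (((k - j : ℤ) : ℝ) * (Real.pi / 3)) = Real.sqrt 3 / 2 := by
    rcases hjk with h | h <;> rw [h]
    · rw [Int.cast_one, one_mul, Real.sin_pi_div_three]
    · rw [← Real.sin_pi_div_three, ← Real.sin_pi_sub (Real.pi / 3)]
      congr 1
      push_cast
      ring
  have hsin' := congrArg (fun x : ℝ => (x : ℂ)) hsin
  simp only [ofReal_sin] at hsin'
  rw [Complex.sin] at hsin'
  have e1 : exp (Real.pi * I / 2 + Real.pi * I * (j + k) / 3) * cubeRoot ^ (-j) =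
      I * exp ((((k - j : ℤ) : ℝ) * (Real.pi / 3) : ℝ) * I) := by
    rw [cubeRoot, ← exp_int_mul, ← Complex.exp_add, show I = exp (Real.pi / 2 * I) from
      exp_pi_div_two_mul_I.symm, ← Complex.exp_add, exp_pi_div_two_mul_I]
    congr 1
    push_cast
    ring
  have e2 : exp (Real.pi * I / 2 + Real.pi * I * (j + k) / 3) * cubeRoot ^ (-k) =
      I * exp (-(((k - j : ℤ) : ℝ) * (Real.pi / 3) : ℝ) * I) := by
    rw [cubeRoot, ← exp_int_mul, ← Complex.exp_add, show I = exp (Real.pi / 2 * I) from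
      exp_pi_div_two_mul_I.symm, ← Complex.exp_add, exp_pi_div_two_mul_I]
    congr 1
    push_cast
    ring
  rw [mul_sub, e1, e2]
  push_cast at hsin' ⊢
  linear_combination -2 * hsin'

end AiryFromScorer

/-! ### The inhomogeneous equation for `Q_r`, `Wi` and their combination. -/

section ParticularSolution

open Topology

lemma deriv_sum_const_mul {ι : Type*} (S : Finset ι) (a : ι → ℂ) {f : ι → ℂ → ℂ}
    (hf : ∀ i, Differentiable ℂ (f i)) :
    deriv (fun z => ∑ i ∈ S, a i * f i z) = fun z => ∑ i ∈ S, a i * deriv (f i) z := by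
  funext z
  exact (HasDerivAt.fun_sum fun i _ => ((hf i) z).hasDerivAt.const_mul (a i)).deriv

lemma deriv_deriv_sum_const_mul {ι : Type*} (S : Finset ι) (a : ι → ℂ) {f : ι → ℂ → ℂ}
    (hf : ∀ i, Differentiable ℂ (f i)) (z : ℂ) :
    deriv (deriv fun z => ∑ i ∈ S, a i * f i z) z = ∑ i ∈ S, a i * deriv (deriv (f i)) z := by
  rw [deriv_sum_const_mul S a hf, deriv_sum_const_mul S a fun i => (hf i).deriv]

/-- Truncated subtraction is harmless: for `n ≤ 1` one of the factors `n`, `n - 1` is `0`. -/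
lemma deriv_deriv_pow (n : ℕ) (z : ℂ) :
    deriv (deriv fun z : ℂ => z ^ n) z = n * ((n - 1 : ℕ) * z ^ (n - 1 - 1)) := by
  have : (deriv fun z : ℂ => z ^ n) = fun z : ℂ => (n : ℂ) * z ^ (n - 1) := by
    funext z; simp
  rw [this, deriv_const_mul_field]
  simp

/-- The numbers `(3s)! / (3^s s!)`. -/
noncomputable def tripleFactorialRatio (s : ℕ) : ℂ :=
  ((3 * s).factorial : ℂ) / (3 ^ s * (s.factorial : ℂ))

lemma tripleFactorialRatio_succ (s : ℕ) : tripleFactorialRatio (s + 1) =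
    (3 * s + 2) * (3 * s + 1) * tripleFactorialRatio s := by
  have h1 : (s.factorial : ℂ) ≠ 0 := by exact_mod_cast s.factorial_ne_zero
  have h2 : (s : ℂ) + 1 ≠ 0 := by exact_mod_cast s.succ_ne_zero
  rw [tripleFactorialRatio, tripleFactorialRatio, show 3 * (s + 1) = 3 * s + 1 + 1 + 1 by ring,
    Nat.factorial_succ, Nat.factorial_succ, Nat.factorial_succ, Nat.factorial_succ]
  push_cast
  field_simp
  ring

/-- Each step multiplies the coefficient by the factor that the ratio loses, so the product is
invariant. The case `t = 0` gives the quadratic coefficient of `Q_{3s+2}`. -/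
lemma airyQCoeff_mul_tripleFactorialRatio (s m t : ℕ) (h : m + t = s) :
    (airyQCoeff (3 * s + 2) m : ℂ) * tripleFactorialRatio (t + 1) =
      tripleFactorialRatio (s + 1) := by
  induction m generalizing t with
  | zero => simp [airyQCoeff, ← h]
  | succ m ih =>
    rw [← ih (t + 1) (by omega), airyQCoeff, tripleFactorialRatio_succ (t + 1),
      show 3 * s + 2 - 3 * (m + 1) = 3 * t + 2 by omega]
    push_cast
    ring

lemma differentiable_airyQ (r : ℕ) : Differentiable ℂ (airyQ r) := by
  unfold airyQ
  fun_prop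

/-- By the recurrence, the second derivative of term `m` is term `m + 1` of `z Q_r`, so the
difference telescopes. There remain `-z^{r+1}` and the second derivative of the lowest monomial,
nonzero only if that monomial is quadratic. -/
lemma deriv_deriv_airyQ (r : ℕ) (z : ℂ) : deriv (deriv (airyQ r)) z =
    z * airyQ r z - z ^ (r + 1) +
      if 3 ∣ r + 1 then tripleFactorialRatio ((r + 1) / 3) else 0 := by
  have h1 : deriv (deriv (airyQ r)) z = ∑ m ∈ Finset.range (r / 3 + 1), (airyQCoeff r m : ℂ) *
      (((r - 3 * m : ℕ) : ℂ) * ((r - 3 * m - 1 : ℕ) * z ^ (r - 3 * m - 1 - 1))) := by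
    unfold airyQ
    rw [deriv_deriv_sum_const_mul _ _ (fun m => differentiable_pow (r - 3 * m))]
    simp only [deriv_deriv_pow]
  set T : ℕ → ℂ := fun m => (airyQCoeff r m : ℂ) * z ^ (r - 3 * m + 1)
  have h2 : z * airyQ r z = ∑ m ∈ Finset.range (r / 3 + 1), T m := by
    rw [airyQ, Finset.mul_sum]
    refine Finset.sum_congr rfl fun m _ => ?_
    simp only [T]
    ring
  have h3 : ∀ m ∈ Finset.range (r / 3), (airyQCoeff r m : ℂ) *
      (((r - 3 * m : ℕ) : ℂ) * ((r - 3 * m - 1 : ℕ) * z ^ (r - 3 * m - 1 - 1))) = T (m + 1) := by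
    intro m hm
    have hm' : m < r / 3 := Finset.mem_range.1 hm
    obtain ⟨t, ht⟩ : ∃ t, r = 3 * (m + 1) + t := ⟨r - 3 * (m + 1), by omega⟩
    simp only [T, airyQCoeff]
    rw [show r - 3 * m = t + 3 by omega, show r - 3 * (m + 1) = t by omega,
      show t + 3 - 1 = t + 2 by omega, show t + 2 - 1 = t + 1 by omega]
    push_cast
    ring
  rw [h1, h2, Finset.sum_range_succ, Finset.sum_congr rfl h3, Finset.sum_range_succ]
  have h4 := Finset.sum_range_sub T (r / 3)
  rw [Finset.sum_sub_distrib] at h4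
  have h5 : T 0 = z ^ (r + 1) := by simp [T, airyQCoeff]
  have h6 : (airyQCoeff r (r / 3) : ℂ) * (((r - 3 * (r / 3) : ℕ) : ℂ) *
      ((r - 3 * (r / 3) - 1 : ℕ) * z ^ (r - 3 * (r / 3) - 1 - 1))) =
      if 3 ∣ r + 1 then tripleFactorialRatio ((r + 1) / 3) else 0 := by
    split_ifs with hd
    · obtain ⟨s, hs⟩ : ∃ s, r = 3 * s + 2 := ⟨r / 3, by omega⟩
      have h7 := airyQCoeff_mul_tripleFactorialRatio s s 0 rfl
      have h8 : tripleFactorialRatio (0 + 1) = 2 := by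
        norm_num [tripleFactorialRatio, Nat.factorial]
      rw [h8] at h7
      rw [show r / 3 = s by omega, show (r + 1) / 3 = s + 1 by omega,
        show r - 3 * s = 2 by omega, hs, ← h7]
      norm_num
    · have h7 : r - 3 * (r / 3) = 0 ∨ r - 3 * (r / 3) = 1 := by omega
      rcases h7 with h7 | h7 <;> rw [h7] <;> simp
  rw [h6]
  linear_combination h4 - h5

lemma sum_range_ite_three_dvd (N : ℕ) (g : ℕ → ℂ) :
    ∑ r ∈ Finset.range (N + 1), (if 3 ∣ r then g r else 0) =
      ∑ s ∈ Finset.range (N / 3 + 1), g (3 * s) := by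
  rw [← Finset.sum_filter]
  refine Finset.sum_nbij' (fun r => r / 3) (fun s => 3 * s) ?_ ?_ ?_ ?_ ?_
  all_goals simp only [Finset.mem_filter, Finset.mem_range]
  · omega
  · omega
  · rintro r ⟨-, hr⟩; omega
  · omega
  · rintro r ⟨-, hr⟩; rw [Nat.mul_div_cancel' hr]

variable {u : ℝ}

lemma rpow_two_thirds_pow_three (hu : 0 < u) :
    (((u ^ (2 / 3 : ℝ) : ℝ) : ℂ)) ^ 3 = (u : ℂ) ^ 2 := by
  norm_cast
  rw [← Real.rpow_natCast, ← Real.rpow_mul hu.le]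
  norm_num

lemma rpow_two_thirds_sq (hu : 0 < u) :
    (((u ^ (2 / 3 : ℝ) : ℝ) : ℂ)) ^ 2 = ((u ^ (4 / 3 : ℝ) : ℝ) : ℂ) := by
  norm_cast
  rw [← Real.rpow_natCast, ← Real.rpow_mul hu.le]
  norm_num

/-- The scaling of the monomials of `Q_{r-1}`. -/
lemma rpow_mul_rpow_two_thirds_pow (hu : 0 < u) (r m N : ℕ) (h : r = N + 1 + 3 * m) :
    ((u ^ (-(2 * ((r : ℝ) + 2) / 3)) : ℝ) : ℂ) * ((u ^ (2 / 3 : ℝ) : ℝ) : ℂ) ^ N =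
      1 / (u : ℂ) ^ 2 / (u : ℂ) ^ (2 * m) := by
  rw [div_div, ← pow_add, one_div]
  norm_cast
  rw [← Real.rpow_natCast, ← Real.rpow_mul hu.le, ← Real.rpow_add hu, ← Real.rpow_natCast,
    ← Real.rpow_neg hu.le, h]
  congr 1
  push_cast
  ring

/-- The chain rule gives the square and `z^r` gives the `r`-th power, so each `p_r z^r` is
reproduced with coefficient one. -/
lemma rpow_mul_rpow_two_thirds_sq (hu : 0 < u) (r : ℕ) :
    ((u ^ (-(2 * ((r : ℝ) + 2) / 3)) : ℝ) : ℂ) * ((u ^ (2 / 3 : ℝ) : ℝ) : ℂ) ^ 2 *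
      ((u ^ (2 / 3 : ℝ) : ℝ) : ℂ) ^ r = 1 := by
  norm_cast
  rw [← Real.rpow_natCast, ← Real.rpow_natCast, ← Real.rpow_mul hu.le, ← Real.rpow_mul hu.le,
    ← Real.rpow_add hu, ← Real.rpow_add hu, show (1 : ℝ) = u ^ (0 : ℝ) from
    (Real.rpow_zero u).symm]
  congr 1
  push_cast
  ring

lemma scorerWi_eq (j k : ℤ) (z : ℂ) : scorerWi j k z =
    cubeRoot ^ (j + k) * scorerMoment 0 (cubeRoot ^ (j + k) * z) := by
  have hpi : (Real.pi : ℂ) ≠ 0 := ofReal_ne_zero.2 Real.pi_ne_zero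
  have h := exp_two_pi_I_int_div_three (j + k)
  push_cast at h
  rw [scorerWi, scorerHi, h, scorerMoment]
  simp only [pow_zero, one_mul]
  rw [← cubeRoot, mul_comm z]
  field_simp

lemma differentiable_scorerWi (j k : ℤ) : Differentiable ℂ (scorerWi j k) := by
  rw [show scorerWi j k = _ from funext (scorerWi_eq j k)]
  exact ((differentiable_scorerMoment 0).comp (differentiable_id.const_mul _)).const_mul _

/-- The prefactor and two differentiations produce the cube of a cube root of unity, so every `Wi`
has inhomogeneity `1`. -/
lemma deriv_deriv_scorerWi (j k : ℤ) (z : ℂ) :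
    deriv (deriv (scorerWi j k)) z = z * scorerWi j k z + 1 := by
  have h := deriv_deriv_sum_const_mul {()} (fun _ => cubeRoot ^ (j + k))
    (f := fun _ z => scorerMoment 0 (cubeRoot ^ (j + k) * z))
    (fun _ => (differentiable_scorerMoment 0).comp (differentiable_id.const_mul _)) z
  simp only [Finset.sum_singleton] at h
  rw [show scorerWi j k = _ from funext (scorerWi_eq j k), h, deriv_deriv_comp_mul_left,
    deriv_scorerMoment, deriv_scorerMoment, scorerMoment_two]
  have h3 := cubeRoot_zpow_pow_three (j + k)
  generalize cubeRoot ^ (j + k) = v at *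
  linear_combination (v * z * scorerMoment 0 (v * z) + 1) * h3

lemma differentiable_polynomialPart (u : ℝ) (p : ℂ[X]) :
    Differentiable ℂ (polynomialPart u p) := by
  unfold polynomialPart
  refine (Differentiable.fun_sum fun r _ => ?_).neg
  exact ((differentiable_airyQ (r - 1)).comp (differentiable_id.const_mul _)).const_mul _

lemma deriv_deriv_polynomialPart (hu : 0 < u) (p : ℂ[X]) (z : ℂ) :
    deriv (deriv (polynomialPart u p)) z = (u : ℂ) ^ 2 * z * polynomialPart u p z +
      p.eval z - ((u ^ (2 / 3 : ℝ) : ℝ) : ℂ) ^ 2 * connectionGamma u p := by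
  set c : ℂ := ((u ^ (2 / 3 : ℝ) : ℝ) : ℂ)
  have hc3 : c ^ 3 = (u : ℂ) ^ 2 := rpow_two_thirds_pow_three hu
  have hu0 : (u : ℂ) ≠ 0 := ofReal_ne_zero.2 hu.ne'
  have hc0 : c ≠ 0 := by
    rintro h
    rw [h] at hc3
    exact pow_ne_zero 2 hu0 (by rw [← hc3]; simp)
  set a : ℕ → ℂ := fun r => ((u ^ (-(2 * ((r : ℝ) + 2) / 3)) : ℝ) : ℂ)
  have ha : ∀ r, a r * c ^ 2 * c ^ r = 1 := rpow_mul_rpow_two_thirds_sq hu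
  have h1 : polynomialPart u p = fun z => ∑ r ∈ Finset.Icc 1 p.natDegree,
      (-(a r * p.coeff r)) * airyQ (r - 1) (c * z) := by
    funext z
    rw [polynomialPart, ← Finset.sum_neg_distrib]
    exact Finset.sum_congr rfl fun r _ => by simp only [a, c]; ring
  have h2 : ∀ r ∈ Finset.Icc 1 p.natDegree,
      (-(a r * p.coeff r)) * deriv (deriv fun z => airyQ (r - 1) (c * z)) z =
      (u : ℂ) ^ 2 * z * ((-(a r * p.coeff r)) * airyQ (r - 1) (c * z)) + p.coeff r * z ^ r -
        if 3 ∣ r then p.coeff r * tripleFactorialRatio (r / 3) / c ^ r else 0 := by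
    intro r hr
    have hr1 : r - 1 + 1 = r := Nat.sub_add_cancel (Finset.mem_Icc.1 hr).1
    rw [deriv_deriv_comp_mul_left, deriv_deriv_airyQ, hr1]
    have ha' : a r * c ^ 2 = (c ^ r)⁻¹ := eq_inv_of_mul_eq_one_left (ha r)
    rw [← hc3, mul_pow]
    split_ifs
    · rw [div_eq_mul_inv, ← ha']
      linear_combination p.coeff r * z ^ r * ha r
    · linear_combination p.coeff r * z ^ r * ha r
  have h3 : c ^ 2 * connectionGamma u p = ∑ r ∈ Finset.range (p.natDegree + 1),
      if 3 ∣ r then p.coeff r * tripleFactorialRatio (r / 3) / c ^ r else 0 := by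
    rw [sum_range_ite_three_dvd, connectionGamma, ← rpow_two_thirds_sq hu, ← mul_assoc,
      mul_one_div_cancel (pow_ne_zero 2 hc0), one_mul]
    refine Finset.sum_congr rfl fun s _ => ?_
    rw [pow_mul c, hc3, ← pow_mul, Nat.mul_div_cancel_left s three_pos, tripleFactorialRatio]
    field_simp
  -- The index `r = 0` is absent from `𝒢` but present in `p` and in `γ`, where its two contributions
  -- `p_0` cancel.
  have h4 : ∀ f : ℕ → ℂ, ∑ r ∈ Finset.range (p.natDegree + 1), f r =
      ∑ r ∈ Finset.Icc 1 p.natDegree, f r + f 0 := fun f => by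
    rw [Finset.range_eq_Ico, Finset.sum_eq_sum_Ico_succ_bot (show 0 < p.natDegree + 1 by omega), zero_add,
      Finset.Ico_add_one_right_eq_Icc, add_comm]
  rw [h3, eval_eq_sum_range, h4, h4, h1, deriv_deriv_sum_const_mul _ _
    (f := fun r z => airyQ (r - 1) (c * z)) (fun r =>
    (differentiable_airyQ (r - 1)).comp (differentiable_id.const_mul c)), Finset.sum_congr rfl h2,
    Finset.sum_sub_distrib, Finset.sum_add_distrib, ← Finset.mul_sum]
  simp [tripleFactorialRatio]
  ring

/-- The combination of a Scorer function and a polynomial that equals the fundamental solution. -/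
noncomputable def scorerSolution (u : ℝ) (p : ℂ[X]) (j k : ℤ) (z : ℂ) : ℂ :=
  connectionGamma u p * scorerWi j k ((u ^ (2 / 3 : ℝ) : ℝ) * z) + polynomialPart u p z

lemma differentiable_scorerSolution (u : ℝ) (p : ℂ[X]) (j k : ℤ) :
    Differentiable ℂ (scorerSolution u p j k) :=
  (((differentiable_scorerWi j k).comp (differentiable_id.const_mul _)).const_mul _).add
    (differentiable_polynomialPart u p)

/-- The constant that `γ Wi` contributes cancels the constant left over by `𝒢`; this is what
determines `γ`. -/
lemma scorerSolution_ode (hu : 0 < u) (p : ℂ[X]) (j k : ℤ) (z : ℂ) :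
    deriv (deriv (scorerSolution u p j k)) z =
      (u : ℂ) ^ 2 * z * scorerSolution u p j k z + p.eval z := by
  set c : ℂ := ((u ^ (2 / 3 : ℝ) : ℝ) : ℂ)
  have hc3 : c ^ 3 = (u : ℂ) ^ 2 := rpow_two_thirds_pow_three hu
  have h := deriv_deriv_sum_const_mul Finset.univ
    (fun b : Bool => if b then connectionGamma u p else 1)
    (f := fun b z => if b then scorerWi j k (c * z) else polynomialPart u p z)
    (fun b => by
      cases b
      · exact differentiable_polynomialPart u p
      · exact (differentiable_scorerWi j k).comp (differentiable_id.const_mul _)) z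
  simp only [Fintype.sum_bool, if_true, Bool.false_eq_true, if_false, one_mul] at h
  unfold scorerSolution
  rw [h, deriv_deriv_comp_mul_left, deriv_deriv_scorerWi, deriv_deriv_polynomialPart hu]
  linear_combination connectionGamma u p * z * scorerWi j k (c * z) * hc3

end ParticularSolution

/-! ### Comparison with the slowly varying expansion. -/

section SlowVariation

open Topology

lemma deriv_sum_const_mul_zpow (S : Finset ℕ) (a : ℕ → ℂ) (e : ℕ → ℤ) {z : ℂ} (hz : z ≠ 0) :
    deriv (fun z => ∑ r ∈ S, a r * z ^ e r) z = ∑ r ∈ S, (a r * e r) * z ^ (e r - 1) := by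
  rw [(HasDerivAt.fun_sum fun r _ =>
    (hasDerivAt_zpow (e r) z (Or.inl hz)).const_mul (a r)).deriv]
  exact Finset.sum_congr rfl fun r _ => by ring

/-- The coefficient of `z^{r-1-3s}` in `-Ĝ_s` for `p = z^r`. -/
noncomputable def slowFactor (r s : ℕ) : ℂ :=
  ∏ i ∈ Finset.range s, (((r : ℂ) - 1 - 3 * i) * ((r : ℂ) - 2 - 3 * i))

lemma slowCoeff_eq (p : ℂ[X]) (s : ℕ) : ∀ z : ℂ, z ≠ 0 → slowCoeff p s z =
    ∑ r ∈ Finset.range (p.natDegree + 1),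
      (-(p.coeff r * slowFactor r s)) * z ^ ((r : ℤ) - 1 - 3 * s) := by
  induction s with
  | zero =>
    intro z hz
    simp only [slowCoeff]
    rw [eval_eq_sum_range, ← Finset.sum_neg_distrib, Finset.sum_div]
    refine Finset.sum_congr rfl fun r _ => ?_
    rw [Nat.cast_zero, mul_zero, sub_zero, zpow_sub_one₀ hz, zpow_natCast, slowFactor]
    simp [div_eq_mul_inv, mul_assoc]
  | succ s ih =>
    intro z hz
    have hne : ∀ z : ℂ, z ≠ 0 → ∀ᶠ x in 𝓝 z, x ≠ 0 := fun z hz => isOpen_ne.mem_nhds hz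
    have h1 : ∀ z : ℂ, z ≠ 0 → deriv (slowCoeff p s) z = ∑ r ∈ Finset.range (p.natDegree + 1),
        (-(p.coeff r * slowFactor r s) * (((r : ℤ) - 1 - 3 * s : ℤ) : ℂ)) *
          z ^ ((r : ℤ) - 1 - 3 * s - 1) := fun z hz => by
      have : slowCoeff p s =ᶠ[𝓝 z] fun z => ∑ r ∈ Finset.range (p.natDegree + 1),
          (-(p.coeff r * slowFactor r s)) * z ^ ((r : ℤ) - 1 - 3 * s) := by
        filter_upwards [hne z hz] with x hx using ih x hx
      rw [this.deriv_eq, deriv_sum_const_mul_zpow _ _ _ hz]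
    have h2 : deriv (slowCoeff p s) =ᶠ[𝓝 z] fun z => ∑ r ∈ Finset.range (p.natDegree + 1),
        (-(p.coeff r * slowFactor r s) * (((r : ℤ) - 1 - 3 * s : ℤ) : ℂ)) *
          z ^ ((r : ℤ) - 1 - 3 * s - 1) := by
      filter_upwards [hne z hz] with x hx using h1 x hx
    simp only [slowCoeff]
    rw [h2.deriv_eq, deriv_sum_const_mul_zpow _ _ _ hz, Finset.sum_div]
    refine Finset.sum_congr rfl fun r _ => ?_
    rw [slowFactor, slowFactor, Finset.prod_range_succ, div_eq_mul_inv, mul_assoc _ (z ^ _),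
      ← zpow_sub_one₀ hz]
    rw [show (r : ℤ) - 1 - 3 * s - 1 - 1 - 1 = (r : ℤ) - 1 - 3 * (s + 1 : ℕ) by push_cast; ring]
    push_cast
    ring

/-- Differentiating twice and dividing by `z` obeys the recurrence for `q`. The bound `3m < r` keeps
the exponent `r - 1 - 3m` nonnegative and the natural subtraction exact. -/
lemma slowFactor_eq_airyQCoeff (r m : ℕ) (h : 3 * m < r) :
    slowFactor r m = airyQCoeff (r - 1) m := by
  induction m with
  | zero => simp [slowFactor, airyQCoeff]
  | succ m ih =>
    rw [slowFactor, Finset.prod_range_succ, ← slowFactor, ih (by omega), airyQCoeff]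
    obtain ⟨t, rfl⟩ : ∃ t, r = 3 * (m + 1) + t + 1 := ⟨r - 1 - 3 * (m + 1), by omega⟩
    rw [show 3 * (m + 1) + t + 1 - 1 - 3 * (m + 1) = t by omega]
    push_cast
    ring

lemma rpow_mul_airyQ_eq {u : ℝ} (hu : 0 < u) {r n : ℕ} (hr : 1 ≤ r) (hrn : r ≤ 3 * n) (z : ℂ) :
    ((u ^ (-(2 * ((r : ℝ) + 2) / 3)) : ℝ) : ℂ) *
      airyQ (r - 1) (((u ^ (2 / 3 : ℝ) : ℝ) : ℂ) * z) =
    ∑ s ∈ Finset.range n with 3 * s < r,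
      1 / (u : ℂ) ^ 2 / (u : ℂ) ^ (2 * s) * (slowFactor r s * z ^ ((r : ℤ) - 1 - 3 * s)) := by
  -- Since `r ≤ 3n`, the truncation at `n` omits no index with `3s < r`.
  have hS : (Finset.range n).filter (fun s => 3 * s < r) = Finset.range ((r - 1) / 3 + 1) := by
    ext s
    simp only [Finset.mem_filter, Finset.mem_range]
    omega
  rw [hS, airyQ, Finset.mul_sum]
  refine Finset.sum_congr rfl fun s hs => ?_
  have hs' : 3 * s < r := by
    have := Finset.mem_range.1 hs
    omega
  rw [← rpow_mul_rpow_two_thirds_pow hu r s (r - 1 - 3 * s) (by omega),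
    slowFactor_eq_airyQCoeff r s hs', mul_pow,
    show (r : ℤ) - 1 - 3 * s = ((r - 1 - 3 * s : ℕ) : ℤ) by omega, zpow_natCast]
  ring

/-- All monomials of nonnegative degree cancel; those left have exponent at most `-1`, hence are
`O(1/z)`. -/
lemma polynomialPart_sub_slow_sum {u : ℝ} (hu : 0 < u) (p : ℂ[X]) {n : ℕ}
    (hn : p.natDegree ≤ 3 * n) {z : ℂ} (hz : z ≠ 0) :
    polynomialPart u p z -
        1 / (u : ℂ) ^ 2 * ∑ s ∈ Finset.range n, slowCoeff p s z / (u : ℂ) ^ (2 * s) =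
      ∑ r ∈ Finset.range (p.natDegree + 1), ∑ s ∈ Finset.range n with ¬ 3 * s < r,
        p.coeff r * (1 / (u : ℂ) ^ 2 / (u : ℂ) ^ (2 * s) * slowFactor r s) *
          z ^ ((r : ℤ) - 1 - 3 * s) := by
  set t : ℕ → ℕ → ℂ := fun r s =>
    1 / (u : ℂ) ^ 2 / (u : ℂ) ^ (2 * s) * (slowFactor r s * z ^ ((r : ℤ) - 1 - 3 * s))
  have h1 : 1 / (u : ℂ) ^ 2 * ∑ s ∈ Finset.range n, slowCoeff p s z / (u : ℂ) ^ (2 * s) =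
      -∑ r ∈ Finset.range (p.natDegree + 1), p.coeff r * ∑ s ∈ Finset.range n, t r s := by
    simp only [Finset.mul_sum, slowCoeff_eq p _ z hz, Finset.sum_div, ← Finset.sum_neg_distrib]
    rw [Finset.sum_comm]
    refine Finset.sum_congr rfl fun r _ => Finset.sum_congr rfl fun s _ => ?_
    simp only [t]
    ring
  have h2 : polynomialPart u p z = -∑ r ∈ Finset.range (p.natDegree + 1),
      p.coeff r * ∑ s ∈ Finset.range n with 3 * s < r, t r s := by
    rw [Finset.range_eq_Ico,
      Finset.sum_eq_sum_Ico_succ_bot (show 0 < p.natDegree + 1 by omega), zero_add,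
      Finset.Ico_add_one_right_eq_Icc, polynomialPart]
    simp only [not_lt_zero, Finset.filter_false, Finset.sum_empty, mul_zero, zero_add]
    congr 1
    refine Finset.sum_congr rfl fun r hr => ?_
    have hr' := Finset.mem_Icc.1 hr
    rw [mul_right_comm, rpow_mul_airyQ_eq hu hr'.1 (hr'.2.trans hn), mul_comm]
  rw [h1, h2, sub_neg_eq_add, neg_add_eq_sub, ← Finset.sum_sub_distrib]
  refine Finset.sum_congr rfl fun r _ => ?_
  rw [← Finset.sum_filter_add_sum_filter_not (Finset.range n) (fun s => 3 * s < r), mul_add,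
    add_sub_cancel_left, Finset.mul_sum]
  refine Finset.sum_congr rfl fun s _ => ?_
  simp only [t]
  ring

lemma eventually_cobounded_one_le_norm : ∀ᶠ z : ℂ in Bornology.cobounded ℂ, 1 ≤ ‖z‖ :=
  tendsto_norm_cobounded_atTop.eventually_ge_atTop 1

lemma polynomialPart_sub_slow_sum_isBigO {u : ℝ} (hu : 0 < u) (p : ℂ[X]) {n : ℕ}
    (hn : p.natDegree ≤ 3 * n) :
    (fun z => polynomialPart u p z -
        1 / (u : ℂ) ^ 2 * ∑ s ∈ Finset.range n, slowCoeff p s z / (u : ℂ) ^ (2 * s))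
      =O[Bornology.cobounded ℂ] fun z => z⁻¹ := by
  have h : (fun z : ℂ => ∑ r ∈ Finset.range (p.natDegree + 1),
      ∑ s ∈ Finset.range n with ¬ 3 * s < r,
        p.coeff r * (1 / (u : ℂ) ^ 2 / (u : ℂ) ^ (2 * s) * slowFactor r s) *
          z ^ ((r : ℤ) - 1 - 3 * s)) =O[Bornology.cobounded ℂ] fun z => z⁻¹ := by
    refine IsBigO.fun_sum fun r _ => IsBigO.fun_sum fun s hs => IsBigO.const_mul_left ?_ _
    have hs' := (Finset.mem_filter.1 hs).2
    refine IsBigO.of_bound 1 ?_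
    filter_upwards [eventually_cobounded_one_le_norm] with z hz
    rw [one_mul, norm_zpow, norm_inv, ← zpow_neg_one]
    exact zpow_le_zpow_right₀ hz (by omega)
  refine h.congr' ?_ EventuallyEq.rfl
  filter_upwards [eventually_cobounded_one_le_norm] with z hz
  exact (polynomialPart_sub_slow_sum hu p hn (norm_pos_iff.1 (by linarith))).symm

lemma scorerWi_isBigO {c : ℝ} (hc : 0 < c) (j k : ℤ) {δ : ℝ} (hδ : 0 < δ) :
    (fun z : ℂ => scorerWi j k (c * z))
      =O[Bornology.cobounded ℂ ⊓ 𝓟 (trimmedSector j k δ)] fun z => z⁻¹ := by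
  obtain ⟨C, hC, h⟩ := norm_scorerMoment_zero_le hδ
  have e := exp_two_pi_I_int_div_three (j + k)
  push_cast at e
  refine IsBigO.of_bound (C * c⁻¹) ?_
  filter_upwards [mem_inf_of_left eventually_cobounded_one_le_norm,
    mem_inf_of_right (mem_principal_self _)] with z hz hs
  have hz0 : z ≠ 0 := norm_pos_iff.1 (by linarith [show 1 ≤ ‖z‖ from hz])
  have hs' : |arg (-(z * exp (2 * Real.pi * I * (j + k) / 3)))| ≤ 2 * Real.pi / 3 - δ := hs
  rw [e] at hs'
  have hcz : cubeRoot ^ (j + k) * (c * z) = c * (z * cubeRoot ^ (j + k)) := by ring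
  rw [scorerWi_eq, norm_mul, norm_cubeRoot_zpow, one_mul, hcz]
  refine (h _ ?_ ?_).trans (le_of_eq ?_)
  · exact mul_ne_zero (ofReal_ne_zero.2 hc.ne') (mul_ne_zero hz0 (zpow_ne_zero _ cubeRoot_ne_zero))
  · rwa [← mul_neg, arg_real_mul _ hc]
  · rw [norm_mul, norm_mul, norm_cubeRoot_zpow, norm_real, Real.norm_of_nonneg hc.le, norm_inv,
      mul_one, mul_inv, mul_assoc]

lemma scorerSolution_isSlowlyVarying {u : ℝ} (hu : 0 < u) (p : ℂ[X]) (j k : ℤ) :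
    IsSlowlyVaryingSolution u p j k (scorerSolution u p j k) where
  differentiable := differentiable_scorerSolution u p j k
  ode z := by rw [scorerSolution_ode hu]; ring
  slowly_varying δ hδ n hn := by
    have h1 := (scorerWi_isBigO (Real.rpow_pos_of_pos hu (2 / 3)) j k hδ).const_mul_left
      (connectionGamma u p)
    have h2 := (polynomialPart_sub_slow_sum_isBigO hu p hn).mono
      (inf_le_left : _ ⊓ 𝓟 (trimmedSector j k δ) ≤ _)
    refine (h1.add h2).congr_left fun z => ?_
    simp only [scorerSolution]
    ring

end SlowVariation

/-! ### Identification of the fundamental solution, and uniqueness. -/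

section FundamentalSolution

open Topology

lemma airyAiRot_eq (l : ℤ) (z : ℂ) : airyAiRot l z = airyAi (cubeRoot ^ (-l) * z) := by
  rw [airyAiRot, cubeRoot, ← exp_int_mul, mul_comm]
  congr 3
  push_cast
  ring

variable {u : ℝ}

/-- The scaled Airy function `Ai_l(u^{2/3} z)`. -/
noncomputable def scaledAiry (u : ℝ) (l : ℤ) (z : ℂ) : ℂ :=
  airyAiRot l ((u ^ (2 / 3 : ℝ) : ℝ) * z)

lemma scaledAiry_eq (u : ℝ) (l : ℤ) : scaledAiry u l = fun z =>
    airyAi ((cubeRoot ^ (-l) * ((u ^ (2 / 3 : ℝ) : ℝ) : ℂ)) * z) := by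
  funext z
  rw [scaledAiry, airyAiRot_eq, mul_assoc]

lemma differentiable_scaledAiry (u : ℝ) (l : ℤ) : Differentiable ℂ (scaledAiry u l) := by
  rw [scaledAiry_eq]
  exact differentiable_airyAi.comp (differentiable_id.const_mul _)

lemma deriv_deriv_scaledAiry (hu : 0 < u) (l : ℤ) (z : ℂ) :
    deriv (deriv (scaledAiry u l)) z = (u : ℂ) ^ 2 * z * scaledAiry u l z := by
  rw [scaledAiry_eq, deriv_deriv_comp_mul_left, deriv_deriv_airyAi,
    ← rpow_two_thirds_pow_three hu]
  linear_combination ((u ^ (2 / 3 : ℝ) : ℝ) : ℂ) ^ 3 * z *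
    airyAi (cubeRoot ^ (-l) * ((u ^ (2 / 3 : ℝ) : ℝ) : ℂ) * z) * cubeRoot_zpow_pow_three (-l)

lemma scaledAiry_zero (u : ℝ) (l : ℤ) : scaledAiry u l 0 = airyAi 0 := by
  simp [scaledAiry_eq]

lemma deriv_scaledAiry_zero (u : ℝ) (l : ℤ) : deriv (scaledAiry u l) 0 =
    cubeRoot ^ (-l) * ((u ^ (2 / 3 : ℝ) : ℝ) : ℂ) * deriv airyAi 0 := by
  rw [scaledAiry_eq, deriv_comp_mul_left, mul_zero, smul_eq_mul]

lemma scaledAiry_on_ray (u : ℝ) (l : ℤ) (s : ℝ) :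
    scaledAiry u l (s * cubeRoot ^ l) = airyAi ((u ^ (2 / 3 : ℝ) * s : ℝ) : ℂ) := by
  simp only [scaledAiry_eq]
  congr 1
  have h : cubeRoot ^ (-l) * cubeRoot ^ l = 1 := by
    rw [← zpow_add₀ cubeRoot_ne_zero, neg_add_cancel, zpow_zero]
  push_cast
  linear_combination ((u ^ (2 / 3 : ℝ) : ℝ) : ℂ) * s * h

/-- On its own ray `Ai_l` is `Ai` on the positive axis, which is bounded; boundedness already
implies the decay. -/
lemma exists_scaledAiry_le_mul_exp (hu : 0 < u) (l : ℤ) {κ : ℝ} (hκ : 0 < κ) :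
    ∃ C : ℝ, ∀ s : ℝ, 0 ≤ s → ‖scaledAiry u l (s * cubeRoot ^ l)‖ ≤ C * Real.exp (-κ * s) ∧
      ‖deriv (scaledAiry u l) (s * cubeRoot ^ l)‖ ≤ C * Real.exp (-κ * s) := by
  obtain ⟨B, hB⟩ := exists_norm_airyAi_le
  obtain ⟨C, hC⟩ := exists_norm_le_mul_exp_of_bounded (C := B) (sq_pos_of_pos hu)
    (hasDerivAt_comp_ofReal_mul (differentiable_scaledAiry u l) (cubeRoot ^ l))
    (fun s => (hasDerivAt_deriv_comp_ofReal_mul (differentiable_scaledAiry u l)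
      (cubeRoot ^ l) s).congr_deriv (by
        rw [deriv_deriv_scaledAiry hu]
        push_cast
        linear_combination (u : ℂ) ^ 2 * s * scaledAiry u l (s * cubeRoot ^ l) *
          cubeRoot_zpow_pow_three l))
    (fun s hs => by
      rw [scaledAiry_on_ray]
      exact hB _ (mul_nonneg (Real.rpow_nonneg hu.le _) hs)) hκ
  refine ⟨C, fun s hs => ⟨(hC s hs).1, ?_⟩⟩
  have := (hC s hs).2
  rwa [norm_mul, norm_cubeRoot_zpow, one_mul] at this

lemma pow_ray_isBigO (b : ℂ) (n : ℕ) :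
    (fun s : ℝ => ((s : ℂ) * b) ^ n) =O[atTop] fun s => Real.exp (1 * s) := by
  have h := (isLittleO_pow_exp_pos_mul_atTop n (b := 1) one_pos).isBigO
  have h1 : (fun s : ℝ => (s : ℂ) ^ n) =O[atTop] fun s => Real.exp (1 * s) :=
    (IsBigO.of_bound 1 (Eventually.of_forall fun s => by
      rw [norm_pow, norm_real, norm_pow, one_mul])).trans h
  refine (h1.const_mul_left (b ^ n)).congr_left fun s => ?_
  ring

lemma exists_norm_le_mul_exp_of_isBigO {f : ℝ → ℂ} (hf : Continuous f) {κ : ℝ}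
    (h : f =O[atTop] fun s => Real.exp (κ * s)) :
    ∃ C : ℝ, ∀ s, 0 ≤ s → ‖f s‖ ≤ C * Real.exp (κ * s) := by
  obtain ⟨B, hB⟩ := h.bound
  obtain ⟨a, ha⟩ := eventually_atTop.1 hB
  obtain ⟨C, hC⟩ := exists_norm_le_of_continuous (f := fun s => f s * (Real.exp (-(κ * s)) : ℝ))
    (a := a) (C := B) (by fun_prop) fun s hs => by
      have h1 := ha s hs
      rw [Real.norm_of_nonneg (Real.exp_pos _).le] at h1
      rw [norm_mul, norm_real, Real.norm_of_nonneg (Real.exp_pos _).le, Real.exp_neg]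
      exact (div_le_iff₀ (Real.exp_pos _)).2 h1
  refine ⟨C, fun s hs => ?_⟩
  have h1 := hC s hs
  rw [norm_mul, norm_real, Real.norm_of_nonneg (Real.exp_pos _).le, Real.exp_neg] at h1
  exact (div_le_iff₀ (Real.exp_pos _)).1 h1

lemma eval_ray_isBigO (p : ℂ[X]) (v : ℂ) :
    (fun s : ℝ => p.eval ((s : ℂ) * v)) =O[atTop] fun s => Real.exp (1 * s) := by
  simp only [eval_eq_sum_range]
  exact IsBigO.fun_sum fun r _ => (pow_ray_isBigO v r).const_mul_left _

lemma polynomialPart_ray_isBigO (u : ℝ) (p : ℂ[X]) (v : ℂ) :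
    (fun s : ℝ => polynomialPart u p ((s : ℂ) * v)) =O[atTop] fun s => Real.exp (1 * s) := by
  simp only [polynomialPart, airyQ]
  refine (IsBigO.fun_sum fun r _ => (IsBigO.fun_sum fun m _ => ?_).const_mul_left _).neg_left
  refine IsBigO.const_mul_left ?_ _
  refine (pow_ray_isBigO (((u ^ (2 / 3 : ℝ) : ℝ) : ℂ) * v) (r - 1 - 3 * m)).congr_left fun s => ?_
  ring

/-- A crude bound is enough, since the Airy factor beats every exponential. The divisibility
condition keeps the rotated Scorer argument off the positive axis. The derivative is bounded through
the function and its second derivative. -/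
lemma exists_scorerSolution_le_mul_exp (hu : 0 < u) (p : ℂ[X]) {j k l : ℤ}
    (hl : ¬ (3 : ℤ) ∣ j + k + l) :
    ∃ C : ℝ, ∀ s : ℝ, 0 ≤ s →
      ‖scorerSolution u p j k (s * cubeRoot ^ l)‖ ≤ C * Real.exp (2 * s) ∧
      ‖deriv (scorerSolution u p j k) (s * cubeRoot ^ l)‖ ≤ C * Real.exp (2 * s) := by
  set v := cubeRoot ^ l
  have hd := differentiable_scorerSolution u p j k
  have hcont : ∀ {g : ℂ → ℂ}, Continuous g → Continuous fun s : ℝ => g (s * v) := fun hg =>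
    hg.comp (by fun_prop)
  have hexp1 : (fun _ : ℝ => (1 : ℂ)) =O[atTop] fun s => Real.exp (1 * s) := by
    simpa using pow_ray_isBigO 1 0
  have h12 : (fun s => Real.exp (1 * s)) =O[atTop] fun s => Real.exp (2 * s) := by
    refine IsBigO.of_bound 1 ?_
    filter_upwards [eventually_ge_atTop 0] with s hs
    rw [Real.norm_of_nonneg (Real.exp_pos _).le, Real.norm_of_nonneg (Real.exp_pos _).le]
    simp only [one_mul]
    exact Real.exp_le_exp.2 (by linarith)
  have h1 : (fun s : ℝ => scorerSolution u p j k (s * v)) =O[atTop] fun s => Real.exp (1 * s) := by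
    simp only [scorerSolution]
    refine IsBigO.add (IsBigO.const_mul_left ?_ _) (polynomialPart_ray_isBigO u p v)
    obtain ⟨C, hC⟩ := exists_norm_scorerMoment_zero_le_on_ray (cubeRoot_zpow_pow_three (j + k + l))
      (cubeRoot_zpow_ne_one hl)
    refine IsBigO.trans (IsBigO.of_bound C ?_) hexp1
    filter_upwards [eventually_ge_atTop 0] with s hs
    have e : cubeRoot ^ (j + k) * (((u ^ (2 / 3 : ℝ) : ℝ) : ℂ) * (s * v)) =
        ((u ^ (2 / 3 : ℝ) * s : ℝ) : ℂ) * cubeRoot ^ (j + k + l) := by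
      rw [zpow_add₀ cubeRoot_ne_zero (j + k) l]
      push_cast
      ring
    rw [scorerWi_eq, norm_mul, norm_cubeRoot_zpow, e, norm_one, one_mul, mul_one]
    exact hC _ (mul_nonneg (Real.rpow_nonneg hu.le _) hs)
  have h2 : (fun s : ℝ => v ^ 2 * deriv (deriv (scorerSolution u p j k)) (s * v)) =O[atTop]
      fun s => Real.exp (2 * s) := by
    simp only [scorerSolution_ode hu]
    refine IsBigO.const_mul_left (IsBigO.add ?_ ((eval_ray_isBigO p v).trans h12)) _
    refine (((pow_ray_isBigO v 1).const_mul_left ((u : ℂ) ^ 2)).mul h1).congr (fun s => by ring)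
      fun s => ?_
    rw [← Real.exp_add]
    ring_nf
  obtain ⟨C1, hC1⟩ := exists_norm_le_mul_exp_of_isBigO (hcont hd.continuous) (h1.trans h12)
  obtain ⟨C2, hC2⟩ := exists_norm_le_mul_exp_of_isBigO
    ((hcont hd.deriv.deriv.continuous).const_mul (v ^ 2)) h2
  obtain ⟨C3, hC3⟩ := exists_norm_deriv_le_mul_exp (C := max C1 C2)
    (hasDerivAt_comp_ofReal_mul hd v) (hasDerivAt_deriv_comp_ofReal_mul hd v)
    (fun s hs => (hC1 s hs).trans (by gcongr; exact le_max_left _ _))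
    (fun s hs => (hC2 s hs).trans (by gcongr; exact le_max_right _ _))
  refine ⟨max C1 C3, fun s hs => ⟨(hC1 s hs).trans (by gcongr; exact le_max_left _ _), ?_⟩⟩
  have h3 := hC3 s hs
  rw [norm_mul, norm_cubeRoot_zpow, one_mul] at h3
  exact h3.trans (by gcongr; exact le_max_right _ _)

lemma airyIntegrand_convergesAtInfinity (hu : 0 < u) (p : ℂ[X]) (l : ℤ) :
    ConvergesAtInfinity l (airyIntegrand u p l) := by
  rw [ConvergesAtInfinity, exp_two_pi_I_int_div_three, ← cubeRoot]
  change IntegrableOn (fun s : ℝ => p.eval ((s : ℂ) * cubeRoot ^ l) *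
    scaledAiry u l (s * cubeRoot ^ l) * cubeRoot ^ l) (Ioi 0)
  obtain ⟨C1, h1⟩ := exists_norm_le_mul_exp_of_isBigO
    (p.continuous.comp (by fun_prop : Continuous fun s : ℝ => (s : ℂ) * cubeRoot ^ l))
    (eval_ray_isBigO p (cubeRoot ^ l))
  obtain ⟨C2, h2⟩ := exists_scaledAiry_le_mul_exp hu l two_pos
  refine Integrable.mono' (((exp_neg_integrableOn_Ioi 0 one_pos).const_mul (C1 * C2)))
    (Continuous.aestronglyMeasurable ?_) ?_
  · have := (differentiable_scaledAiry u l).continuous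
    have := p.continuous
    fun_prop
  · filter_upwards [ae_restrict_mem measurableSet_Ioi] with s hs
    have hs' : 0 ≤ s := le_of_lt hs
    rw [norm_mul, norm_mul, norm_cubeRoot_zpow, mul_one]
    refine (mul_le_mul (h1 s hs') (h2 s hs').1 (norm_nonneg _)
      ((norm_nonneg _).trans (h1 s hs'))).trans (le_of_eq ?_)
    rw [mul_mul_mul_comm, ← Real.exp_add]
    ring_nf

lemma hasDerivAt_wronskian {w a : ℂ → ℂ} (hw : Differentiable ℂ w) (ha : Differentiable ℂ a)
    (z : ℂ) : HasDerivAt (fun z => deriv w z * a z - w z * deriv a z)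
      (deriv (deriv w) z * a z - w z * deriv (deriv a) z) z := by
  refine (((hw.deriv z).hasDerivAt.mul (ha z).hasDerivAt).sub
    ((hw z).hasDerivAt.mul (ha.deriv z).hasDerivAt)).congr_deriv ?_
  ring

/-- The right-hand side is a primitive of the integrand and tends to `0` along ray `l`, where growth
`e^{2s}` meets decay `e^{-3s}`. The values at `0` from the ray and the segment cancel. -/
lemma integralFromInfinity_airyIntegrand (hu : 0 < u) (p : ℂ[X]) {j k l : ℤ}
    (hl : ¬ (3 : ℤ) ∣ j + k + l) (z : ℂ) :
    integralFromInfinity l (airyIntegrand u p l) z =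
      deriv (scorerSolution u p j k) z * scaledAiry u l z -
        scorerSolution u p j k z * deriv (scaledAiry u l) z := by
  set w := scorerSolution u p j k
  set a := scaledAiry u l
  have hw : Differentiable ℂ w := differentiable_scorerSolution u p j k
  have ha : Differentiable ℂ a := differentiable_scaledAiry u l
  set F : ℂ → ℂ := fun z => deriv w z * a z - w z * deriv a z
  have hF : ∀ z, HasDerivAt F (airyIntegrand u p l z) z := fun z => by
    refine (hasDerivAt_wronskian hw ha z).congr_deriv ?_
    rw [scorerSolution_ode hu, deriv_deriv_scaledAiry hu]
    change _ = p.eval z * a z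
    simp only [w, a]
    ring
  have hFd : Differentiable ℂ F := fun z => (hF z).differentiableAt
  have hray : ∀ (v : ℂ) (s : ℝ), HasDerivAt (fun s : ℝ => F (s * v))
      (airyIntegrand u p l (s * v) * v) s := fun v s => by
    refine (hasDerivAt_comp_ofReal_mul hFd v s).congr_deriv ?_
    rw [(hF _).deriv, mul_comm]
  have hcont : Continuous (airyIntegrand u p l) := p.continuous.mul ha.continuous
  have hconv := airyIntegrand_convergesAtInfinity hu p l
  rw [ConvergesAtInfinity, exp_two_pi_I_int_div_three, ← cubeRoot] at hconv
  have hlim : Tendsto (fun s : ℝ => F (s * cubeRoot ^ l)) atTop (𝓝 0) := by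
    obtain ⟨C1, h1⟩ := exists_scorerSolution_le_mul_exp hu p hl
    obtain ⟨C2, h2⟩ := exists_scaledAiry_le_mul_exp hu l three_pos
    refine squeeze_zero_norm' ?_ (tendsto_mul_exp_neg (2 * (C1 * C2)) one_pos)
    filter_upwards [eventually_ge_atTop 0] with s hs
    have hC1 := (norm_nonneg _).trans (h1 s hs).1
    calc ‖F (s * cubeRoot ^ l)‖ ≤ C1 * Real.exp (2 * s) * (C2 * Real.exp (-3 * s)) +
          C1 * Real.exp (2 * s) * (C2 * Real.exp (-3 * s)) := by
          refine (norm_sub_le _ _).trans ?_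
          rw [norm_mul, norm_mul]
          exact add_le_add (mul_le_mul (h1 s hs).2 (h2 s hs).1 (norm_nonneg _) hC1)
            (mul_le_mul (h1 s hs).1 (h2 s hs).2 (norm_nonneg _) hC1)
      _ = 2 * (C1 * C2) * (Real.exp (2 * s) * Real.exp (-3 * s)) := by ring
      _ = _ := by rw [← Real.exp_add]; ring_nf
  rw [integralFromInfinity, exp_two_pi_I_int_div_three, ← cubeRoot,
    integral_Ioi_of_hasDerivAt_of_tendsto' (fun s _ => hray (cubeRoot ^ l) s) hconv hlim,
    intervalIntegral.integral_eq_sub_of_hasDerivAt (fun s _ => hray z s)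
      (Continuous.intervalIntegrable (by fun_prop) _ _)]
  simp only [F, ofReal_zero, ofReal_one, zero_mul, one_mul]
  ring

/-- Both functions solve the same equation without first-order term, so the Wronskian is constant
and may be evaluated at `0`. -/
lemma wronskian_scaledAiry (hu : 0 < u) (j k : ℤ) (z : ℂ) :
    deriv (scaledAiry u j) z * scaledAiry u k z - scaledAiry u j z * deriv (scaledAiry u k) z =
      -((1 / (2 * Real.pi * Real.sqrt 3) : ℝ) : ℂ) * ((u ^ (2 / 3 : ℝ) : ℝ) : ℂ) *
        (cubeRoot ^ (-j) - cubeRoot ^ (-k)) := by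
  have hd := fun z => (hasDerivAt_wronskian (differentiable_scaledAiry u j)
    (differentiable_scaledAiry u k) z).congr_deriv (g' := 0) (by
      rw [deriv_deriv_scaledAiry hu, deriv_deriv_scaledAiry hu]
      ring)
  rw [is_const_of_deriv_eq_zero (fun z => (hd z).differentiableAt) (fun z => (hd z).deriv) z 0,
    scaledAiry_zero, scaledAiry_zero, deriv_scaledAiry_zero, deriv_scaledAiry_zero,
    ← airyAi_zero_mul_deriv]
  ring

lemma airyFundamental_eq_scorerSolution (hu : 0 < u) (p : ℂ[X]) {j k : ℤ}
    (hj : -1 ≤ j) (hjk : j < k) (hk : k ≤ 1) :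
    airyFundamental u p j k = scorerSolution u p j k := by
  funext z
  have hc : ((u ^ (-(2 / 3) : ℝ) : ℝ) : ℂ) * ((u ^ (2 / 3 : ℝ) : ℝ) : ℂ) = 1 := by
    norm_cast
    rw [← Real.rpow_add hu]
    norm_num
  have hE := exp_mul_cubeRoot_sub (j := j) (k := k) (by omega)
  have hW := wronskian_scaledAiry hu j k z
  have hπ : 2 * (Real.pi : ℂ) * ((Real.sqrt 3 : ℝ) : ℂ) *
      ((1 / (2 * Real.pi * Real.sqrt 3) : ℝ) : ℂ) = 1 := by
    norm_cast
    field_simp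
  -- Modulo 3, `j + k + j ≡ k - j` and `j + k + k ≡ j - k`, both nonzero since `k - j` is `1` or
  -- `2`.
  rw [airyFundamental, integralFromInfinity_airyIntegrand hu p (j := j) (k := k) (by omega),
    integralFromInfinity_airyIntegrand hu p (j := j) (k := k) (by omega)]
  change _ * _ * _ * (scaledAiry u j z * _ - scaledAiry u k z * _) = _
  generalize exp (Real.pi * I / 2 + Real.pi * I * (j + k) / 3) = E at *
  calc _ = 2 * Real.pi * E * ((u ^ (-(2 / 3) : ℝ) : ℝ) : ℂ) * scorerSolution u p j k z *
        (deriv (scaledAiry u j) z * scaledAiry u k z -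
          scaledAiry u j z * deriv (scaledAiry u k) z) := by ring
    _ = -(2 * Real.pi * ((1 / (2 * Real.pi * Real.sqrt 3) : ℝ) : ℂ)) *
        (((u ^ (-(2 / 3) : ℝ) : ℝ) : ℂ) * ((u ^ (2 / 3 : ℝ) : ℝ) : ℂ)) *
        (E * (cubeRoot ^ (-j) - cubeRoot ^ (-k))) * scorerSolution u p j k z := by
      rw [hW]; ring
    _ = _ := by
      rw [hc, hE]
      linear_combination scorerSolution u p j k z * hπ

lemma exists_norm_le_on_ray_of_isBigO {g : ℂ → ℂ} (hg : Continuous g) {j k l : ℤ}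
    (hl : ¬ (3 : ℤ) ∣ l + (j + k))
    (h : g =O[Bornology.cobounded ℂ ⊓ 𝓟 (trimmedSector j k (Real.pi / 3))] fun z => z⁻¹) :
    ∃ C : ℝ, ∀ s : ℝ, 0 ≤ s → ‖g (s * cubeRoot ^ l)‖ ≤ C := by
  have e := exp_two_pi_I_int_div_three (j + k)
  push_cast at e
  have hn : ∀ s : ℝ, 0 ≤ s → ‖(s : ℂ) * cubeRoot ^ l‖ = s := fun s hs => by
    rw [norm_mul, norm_cubeRoot_zpow, mul_one, norm_real, Real.norm_of_nonneg hs]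
  have ht : Tendsto (fun s : ℝ => (s : ℂ) * cubeRoot ^ l) atTop
      (Bornology.cobounded ℂ ⊓ 𝓟 (trimmedSector j k (Real.pi / 3))) := by
    refine tendsto_inf.2 ⟨tendsto_norm_atTop_iff_cobounded.1 ?_, tendsto_principal.2 ?_⟩
    · refine tendsto_id.congr' ?_
      filter_upwards [eventually_ge_atTop 0] with s hs using (hn s hs).symm
    · filter_upwards [eventually_gt_atTop 0] with s hs
      change |arg (-((s : ℂ) * cubeRoot ^ l * exp (2 * Real.pi * I * (j + k) / 3)))| ≤ _
      rw [e, ← cubeRoot, mul_assoc, ← zpow_add₀ cubeRoot_ne_zero, ← mul_neg, arg_real_mul _ hs,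
        abs_arg_neg_of_pow_three (cubeRoot_zpow_pow_three _) (cubeRoot_zpow_ne_one hl)]
      linarith
  obtain ⟨C, hC⟩ := (h.comp_tendsto ht).bound
  obtain ⟨a, ha⟩ := eventually_atTop.1 hC
  refine exists_norm_le_of_continuous (f := fun s : ℝ => g (s * cubeRoot ^ l)) (C := |C|)
    (a := max a 1) (hg.comp (by fun_prop)) fun s hs => ?_
  have h1 : 1 ≤ s := (le_max_right _ _).trans hs
  have h2 := ha s ((le_max_left _ _).trans hs)
  simp only [Function.comp_apply, norm_inv, hn s (by linarith)] at h2
  have h3 : s⁻¹ ≤ 1 := inv_le_one_of_one_le₀ h1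
  have h4 : 0 ≤ s⁻¹ := inv_nonneg.2 (by linarith)
  calc _ ≤ C * s⁻¹ := h2
    _ ≤ |C| * s⁻¹ := mul_le_mul_of_nonneg_right (le_abs_self C) h4
    _ ≤ |C| := mul_le_of_le_one_right (abs_nonneg C) h3

lemma IsSlowlyVaryingSolution.unique (hu : 0 < u) {p : ℂ[X]} {j k : ℤ}
    (hj : -1 ≤ j) (hjk : j < k) (hk : k ≤ 1) {w₁ w₂ : ℂ → ℂ}
    (h₁ : IsSlowlyVaryingSolution u p j k w₁) (h₂ : IsSlowlyVaryingSolution u p j k w₂) :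
    w₁ = w₂ := by
  have hd : Differentiable ℂ (w₁ - w₂) := h₁.differentiable.sub h₂.differentiable
  have hO : (w₁ - w₂) =O[Bornology.cobounded ℂ ⊓ 𝓟 (trimmedSector j k (Real.pi / 3))]
      fun z => z⁻¹ := by
    have hpi : 0 < Real.pi / 3 := by positivity
    -- Any admissible truncation works: the same sum cancels in the difference.
    have hn : p.natDegree ≤ 3 * p.natDegree := by omega
    refine ((h₁.slowly_varying _ hpi _ hn).sub (h₂.slowly_varying _ hpi _ hn)).congr_left
      fun z => ?_
    simp
  obtain ⟨C, hC⟩ := exists_norm_le_on_ray_of_isBigO hd.continuous (l := j) (by omega) hO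
  obtain ⟨C', hC'⟩ := exists_norm_le_on_ray_of_isBigO hd.continuous (l := k) (by omega) hO
  have hne : cubeRoot ^ j ≠ cubeRoot ^ k := fun h => by
    refine cubeRoot_zpow_ne_one (n := k - j) (by omega) ?_
    rw [zpow_sub₀ cubeRoot_ne_zero, h, div_self (zpow_ne_zero _ cubeRoot_ne_zero)]
  refine sub_eq_zero.1 (eq_zero_of_bounded_on_rays (sq_pos_of_pos hu) hd (fun z => ?_)
    (cubeRoot_zpow_pow_three j) (cubeRoot_zpow_pow_three k) hne hC hC')
  have e1 : deriv (w₁ - w₂) = deriv w₁ - deriv w₂ := funext fun z =>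
    deriv_sub (h₁.differentiable z) (h₂.differentiable z)
  rw [e1, deriv_sub (h₁.differentiable.deriv z) (h₂.differentiable.deriv z), Pi.sub_apply]
  push_cast
  linear_combination h₁.ode z - h₂.ode z

end FundamentalSolution

theorem mainTheorem6 (u : ℝ) (hu : 0 < u) (p : Polynomial ℂ) (j k : ℤ)
    (hj : -1 ≤ j) (hjk : j < k) (hk : k ≤ 1) :
    (ConvergesAtInfinity j (airyIntegrand u p j) ∧
      ConvergesAtInfinity k (airyIntegrand u p k)) ∧
    (∀ w : ℂ → ℂ, IsSlowlyVaryingSolution u p j k w ↔ w = airyFundamental u p j k) ∧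
    (∀ z : ℂ, airyFundamental u p j k z =
      connectionGamma u p * scorerWi j k ((u ^ (2 / 3 : ℝ) : ℝ) * z) +
        polynomialPart u p z) := by
  rw [airyFundamental_eq_scorerSolution hu p hj hjk hk]
  have hs := scorerSolution_isSlowlyVarying hu p j k
  refine ⟨⟨airyIntegrand_convergesAtInfinity hu p j, airyIntegrand_convergesAtInfinity hu p k⟩,
    fun w => ⟨fun hw => hw.unique hu hj hjk hk hs, ?_⟩, fun z => rfl⟩
  rintro rfl
  exact hs
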